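/- Let $B_\infty$ be the braid group on infinitely many strands, with generators $s_1,s_2,\dots$ and relations $s_is_j=s_js_i$ ($|i-j|\ge 2$), $s_is_{i+1}s_i=s_{i+1}s_is_{i+1}$; let $\Gamma_\infty=B_\infty/\langle s_1^3\rangle$, and for $n\ge 1$ let $\Gamma_n'$ be the subgroup of $\Gamma_\infty$ generated by $s_1,\dots,s_{n-1}$. Let $K_\infty=\mathbb Z\Gamma_\infty/(\mathbf q)$, where $(\mathbf q)$ is the two-sided ideal generated by $$\mathbf q=1+s_1s_2^2+s_2s_1^2+s_1^2s_2+s_2^2s_1+s_1s_2s_1+s_1^2s_2^2s_1^2+s_1s_2^2s_1s_2^2 .$$ Let $R=(\mathbb Z/4)[j]=(\mathbb Z/4)[x]/(x^2+x+1)$ and $\mu_3=\{1,j,j^2\}$. For distinct $\alpha,\beta\in\mu_3$ let $J(\alpha,\beta)$ be the two-sided ideal of $R\Gamma_\infty$ generated by $(s_1-\alpha)(s_1-\beta)$, let $H_\infty(\alpha,\beta)=R\Gamma_\infty/J(\alpha,\beta)$ (a Hecke algebra), and let $\mathcal H_\infty=R\Gamma_\infty/\big(J(1,j)\cap J(1,j^2)\cap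 J(j,j^2)\big)$ (the ternary Hecke algebra), with projections $p_\gamma:\mathcal H_\infty\to H_\infty(\alpha,\beta)$ for $\{\alpha,\beta,\gamma\}=\mu_3$. For a commutative ring $S$, a quotient $H$ of $S\Gamma_\infty$ and an $S[u,v]$-module $M$, a *Markov trace* is an $S$-linear map $t:H\to M$ with $t(xy)=t(yx)$ for all $x,y\in H$, and $t(xs_n)=u\,t(x)$, $t(xs_n^{-1})=v\,t(x)$ for all $n\ge1$ and all $x$ in the image of $S\Gamma_n'$. Put $f=u^3+uv+v^3+1$. Then: 1. The map $s_i\mapsto s_i$ defines a ring morphism $\pi:K_\infty\to\mathcal H_\infty$. 2. For each $\gamma\in\mu_3$, with $\{\alpha,\beta,\gamma\}=\mu_3$, there is a Markov trace $\mathrm{tr}_\gamma:H_\infty(\alpha,\beta)\to R[u,v]/(v+\gamma u+\gamma^2)$ with $\mathrm{tr}_\gamma(1)=1$. 3. There is a Markov trace $\bar t:\mathcal H_\infty\to R[u,v]/(f)$ with $\bar t(1)=1$, such that for every $h\in\mathcal H_\infty$, $\bar t(h)$ is the unique element of $R[u,v]/(f)$ whose image in $R[u,v]/(v+\gamma u+\gamma^2)$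 is $\mathrm{tr}_\gamma(p_\gamma(h))$ for each $\gamma\in\mu_3$. Moreover there is a Markov trace $\bar t_0:K_\infty\to(\mathbb Z/4)[u,v]/(f)$ with $\bar t_0(1)=1$, and $\bar t\circ\pi$ is $\bar t_0$ followed by the natural map $(\mathbb Z/4)[u,v]/(f)\to R[u,v]/(f)$. 4. Let $M$ be any $\mathbb Z[u,v]$-module and $t:K_\infty\to M$ a Markov trace with $4\,t(1)=0$. Then $t$ factors through the image $\pi(K_\infty)\subset\mathcal H_\infty$. Moreover $t$ takes its values in $N=\mathbb Z[u,v]\,t(1)$, and there is a Markov trace $t':\mathcal H_\infty\to R[u,v]\otimes_{\mathbb Z[u,v]}N$ such that $t'(\pi(x))=1\otimes t(x)$ for all $x\in K_\infty$, and such that $t'$ is obtained from $\bar t$ by specialization: if $\bar t(h)$ is the class of $P\in R[u,v]$, then $t'(h)=P\otimes t(1)$. -/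

import Mathlib

open MvPolynomial
open scoped TensorProduct

noncomputable section

/-! ### The groups -/

/-- Defining relators on the generators `s_1, s_2, …` (the index `i : ℕ` stands for `s_{i+1}`):
the braid relations on infinitely many strands, and `s_1 ^ 3`. -/
def gammaRels : Set (FreeGroup ℕ) :=
  {r | ∃ i j : ℕ, i + 2 ≤ j ∧ r = FreeGroup.of i * FreeGroup.of j *
      (FreeGroup.of j * FreeGroup.of i)⁻¹} ∪
  {r | ∃ i : ℕ, r = FreeGroup.of i * FreeGroup.of (i + 1) * FreeGroup.of i *
      (FreeGroup.of (i + 1) * FreeGroup.of i * FreeGroup.of (i + 1))⁻¹} ∪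
  {FreeGroup.of 0 ^ 3}

/-- `Γ_∞ = B_∞ / ⟨s_1 ^ 3⟩`, the direct limit of the groups `Γ_n = B_n / ⟨s_1 ^ 3⟩`. -/
abbrev GammaInf : Type := PresentedGroup gammaRels

/-- The generator `s_{i+1}` of `Γ_∞`. -/
def sGen (i : ℕ) : GammaInf := PresentedGroup.of i

/-- The image in `Γ_∞` of the group `Γ_{n+1}` on `n + 1` strands: the subgroup generated by
`s_1, …, s_n`. -/
def strands (n : ℕ) : Subgroup GammaInf := Subgroup.closure (sGen '' {i | i < n})

/-! ### Quotients of group algebras -/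

/-- The group algebra `S Γ_∞`, the direct limit of the `S Γ_n`. -/
abbrev GroupAlg (S : Type) [CommRing S] : Type := MonoidAlgebra S GammaInf

/-- The canonical map `Γ_∞ → S Γ_∞`. -/
abbrev gr (S : Type) [CommRing S] : GammaInf →* GroupAlg S := MonoidAlgebra.of S GammaInf

/-- The quotient of `S Γ_∞` by a two-sided ideal. -/
abbrev QuotAlg {S : Type} [CommRing S] (I : TwoSidedIdeal (GroupAlg S)) : Type :=
  GroupAlg S ⧸ I.asIdeal

/-- The canonical map from `Γ_∞` to a quotient of `S Γ_∞`. -/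
def toQuot {S : Type} [CommRing S] (I : TwoSidedIdeal (GroupAlg S)) : GammaInf →* QuotAlg I :=
  ((Ideal.Quotient.mk I.asIdeal : GroupAlg S →+* QuotAlg I) : GroupAlg S →* QuotAlg I).comp (gr S)

/-! ### The algebra `K_∞` -/

/-- The element `q` of `ℤ Γ_3`: the sum of the elements of the quaternion subgroup of `Γ_3`. -/
def qElt : GroupAlg ℤ :=
  let a := gr ℤ (sGen 0)
  let b := gr ℤ (sGen 1)
  1 + a * b ^ 2 + b * a ^ 2 + a ^ 2 * b + b ^ 2 * a + a * b * a + a ^ 2 * b ^ 2 * a ^ 2 +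
    a * b ^ 2 * a * b ^ 2

/-- The two-sided ideal of `ℤ Γ_∞` generated by `q`. -/
def idealK : TwoSidedIdeal (GroupAlg ℤ) := TwoSidedIdeal.span {qElt}

/-- `K_∞`, the direct limit of the `K_n = ℤ Γ_n / (q)`. -/
abbrev KInf : Type := QuotAlg idealK

/-! ### Hecke algebras and the ternary Hecke algebra over `(ℤ/4)[j]` -/

/-- `(ℤ/4)[j] = (ℤ/4)[x] / (x ^ 2 + x + 1)`. -/
abbrev R4 : Type := AdjoinRoot (Polynomial.X ^ 2 + Polynomial.X + 1 : Polynomial (ZMod 4))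

/-- The class `j` of `x`. -/
def jR : R4 := AdjoinRoot.root _

/-- The two-sided ideal `J_∞(α, β)` generated by `(s_1 - α) (s_1 - β)`. -/
def idealH (α β : R4) : TwoSidedIdeal (GroupAlg R4) :=
  TwoSidedIdeal.span {(gr R4 (sGen 0) - algebraMap R4 _ α) * (gr R4 (sGen 0) - algebraMap R4 _ β)}

/-- For `γ = j ^ k`, the ideal `J_∞(α, β)` where `{α, β, γ} = {1, j, j ^ 2}`. -/
def idealHγ (k : Fin 3) : TwoSidedIdeal (GroupAlg R4) :=
  idealH (jR ^ ((k : ℕ) + 1)) (jR ^ ((k : ℕ) + 2))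

/-- For `γ = j ^ k`, the Hecke algebra `H_∞(α, β)` where `{α, β, γ} = {1, j, j ^ 2}`. -/
abbrev HeckeInf (k : Fin 3) : Type := QuotAlg (idealHγ k)

/-- `J_∞`, the intersection of the three ideals `J_∞(α, β)`. As directed unions commute with finite
intersections, it is the union of the images of the ideals
`J_n = J_n(1, j) ∩ J_n(1, j ^ 2) ∩ J_n(j, j ^ 2)` of the `R4 Γ_n`. -/
def idealTernary : TwoSidedIdeal (GroupAlg R4) := ⨅ k : Fin 3, idealHγ k

/-- The ternary Hecke algebra `𝓗_∞`, the direct limit of the `𝓗_n = R4 Γ_n / J_n`. -/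
abbrev TernaryInf : Type := QuotAlg idealTernary

lemma idealTernary_le (k : Fin 3) : idealTernary.asIdeal ≤ (idealHγ k).asIdeal :=
  TwoSidedIdeal.asIdeal.monotone (iInf_le _ k)

/-- The natural projection `𝓗_∞ → H_∞(α, β)`. -/
def projHecke (k : Fin 3) : TernaryInf →ₐ[R4] HeckeInf k :=
  Ideal.Quotient.factorₐ R4 (idealTernary_le k)

/-! ### Rings of values; `X 0` and `X 1` are the variables `u` and `v` -/

/-- `S[u, v]`. -/
abbrev PolyUV (S : Type) [CommRing S] : Type := MvPolynomial (Fin 2) S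

/-- The polynomial `u ^ 3 + u v + v ^ 3 + 1`. -/
def cubicPoly (S : Type) [CommRing S] : PolyUV S := X 0 ^ 3 + X 0 * X 1 + X 1 ^ 3 + 1

/-- `S[u, v] / (u ^ 3 + u v + v ^ 3 + 1)`. -/
abbrev CubicRing (S : Type) [CommRing S] : Type := PolyUV S ⧸ Ideal.span {cubicPoly S}

/-- For `γ = j ^ k`, the polynomial `v + γ u + γ ^ 2`. -/
def linPoly (k : Fin 3) : PolyUV R4 := X 1 + C (jR ^ (k : ℕ)) * X 0 + C ((jR ^ (k : ℕ)) ^ 2)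

/-- For `γ = j ^ k`, the ring `(ℤ/4)[j][u, v] / (v + γ u + γ ^ 2)`. -/
abbrev LinRing (k : Fin 3) : Type := PolyUV R4 ⧸ Ideal.span {linPoly k}

lemma jR_rel : jR ^ 2 + jR + 1 = 0 := by
  have h := AdjoinRoot.eval₂_root
    (Polynomial.X ^ 2 + Polynomial.X + 1 : Polynomial (ZMod 4))
  simpa [Polynomial.eval₂_add, jR] using h

lemma four_R4 : (4 : R4) = 0 := by
  have h : (AdjoinRoot.of (Polynomial.X ^ 2 + Polynomial.X + 1 : Polynomial (ZMod 4))) 4 = 0 := by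
    rw [show (4 : ZMod 4) = 0 from rfl, map_zero]
  rw [map_ofNat] at h
  exact h

lemma cubicPoly_eq_prod : cubicPoly R4 = linPoly 0 * linPoly 1 * linPoly 2 := by
  have hj : (C jR : PolyUV R4) ^ 2 + C jR + 1 = 0 := by
    rw [← map_pow, ← map_add, ← C_1, ← map_add, jR_rel, map_zero]
  have h4 : (4 : PolyUV R4) = 0 := by
    rw [show (4 : PolyUV R4) = C (4 : R4) from (map_ofNat C 4).symm, four_R4, map_zero]
  simp only [cubicPoly, linPoly, map_pow, Fin.val_zero, Fin.val_one, Fin.val_two]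
  generalize (C jR : PolyUV R4) = j at *
  generalize (X 0 : PolyUV R4) = u at *
  generalize (X 1 : PolyUV R4) = v at *
  have hj2 : j ^ 2 = -j - 1 := by linear_combination hj
  have hj3 : j ^ 3 = 1 := by linear_combination (j - 1) * hj
  have hj4 : j ^ 4 = j := by linear_combination j * hj3
  have hj5 : j ^ 5 = -j - 1 := by linear_combination j ^ 2 * hj3 + hj2
  have hj6 : j ^ 6 = 1 := by linear_combination (j ^ 3 + 1) * hj3
  ring_nf
  simp only [hj2, hj3, hj4, hj5, hj6]
  ring_nf
  linear_combination (u * v) * h4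

lemma cubic_le_lin (k : Fin 3) : Ideal.span {cubicPoly R4} ≤ Ideal.span {linPoly k} := by
  rw [Ideal.span_singleton_le_span_singleton, cubicPoly_eq_prod]
  fin_cases k
  · exact Dvd.intro _ (mul_assoc _ _ _).symm
  · exact Dvd.intro_left (linPoly 0 * linPoly 2) (by simp only [Fin.mk_one]; ring)
  · exact Dvd.intro_left _ rfl

/-- For `γ = j ^ k`, the reduction
`(ℤ/4)[j][u, v] / (u ^ 3 + u v + v ^ 3 + 1) → (ℤ/4)[j][u, v] / (v + γ u + γ ^ 2)`. -/
def redLin (k : Fin 3) : CubicRing R4 →+* LinRing k := Ideal.Quotient.factor (cubic_le_lin k)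

instance algebraUVR4 : Algebra (PolyUV ℤ) (PolyUV R4) := MvPolynomial.algebraMvPolynomial

instance algebraUVZMod4 : Algebra (PolyUV ℤ) (PolyUV (ZMod 4)) := MvPolynomial.algebraMvPolynomial

/-- The base change map
`(ℤ/4)[u, v] / (u ^ 3 + u v + v ^ 3 + 1) → (ℤ/4)[j][u, v] / (u ^ 3 + u v + v ^ 3 + 1)`. -/
def adjoinJ : CubicRing (ZMod 4) →+* CubicRing R4 :=
  Ideal.quotientMap _ (MvPolynomial.map (algebraMap (ZMod 4) R4)) (by
    rw [Ideal.span_le, Set.singleton_subset_iff, SetLike.mem_coe, Ideal.mem_comap]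
    have h : MvPolynomial.map (algebraMap (ZMod 4) R4) (cubicPoly (ZMod 4)) = cubicPoly R4 := by
      simp [cubicPoly]
    rw [h]
    exact Ideal.mem_span_singleton_self _)

/-! ### Markov traces -/

/-- Let `H` be an `S`-algebra with a morphism `ρ : Γ_∞ → H` (below: a quotient of `S Γ_∞`), and `M`
an `S[u, v]`-module. An `S`-linear map `t : H → M` is a Markov trace if `t (x y) = t (y x)`, and
`t (x s_{n+1}) = u t (x)`, `t (x s_{n+1}⁻¹) = v t (x)` for all `n` and all `x` in the image of the
group algebra of `Γ_{n+1}`. -/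
structure IsMarkovTrace {S : Type} [CommRing S] {H : Type} [Ring H] [Algebra S H] {M : Type*}
    [AddCommGroup M] [Module S M] [Module (PolyUV S) M] [IsScalarTower S (PolyUV S) M]
    (ρ : GammaInf →* H) (t : H →ₗ[S] M) : Prop where
  trace_mul_comm : ∀ x y : H, t (x * y) = t (y * x)
  trace_mul_gen : ∀ n : ℕ, ∀ x ∈ Submodule.span S (ρ '' (strands n : Set GammaInf)),
    t (x * ρ (sGen n)) = (X 0 : PolyUV S) • t x
  trace_mul_gen_inv : ∀ n : ℕ, ∀ x ∈ Submodule.span S (ρ '' (strands n : Set GammaInf)),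
    t (x * ρ (sGen n)⁻¹) = (X 1 : PolyUV S) • t x

end

noncomputable section

/-! ### Relations in `Γ_∞` -/

/-! Three facts carry the proof.

Upper bound. Modulo `q`, the algebra on one more strand is spanned by the previous algebra `K`
together with `K s K` and `K s⁻¹ K`, `s` being the new generator (`toQuot_mem_bispan`). Cyclicity
and the Markov conditions then give `t(x) = P • t(1)`, with a polynomial `P` over `ℤ` that depends
on `x` and not on `t` (`exists_markovPoly`). Evaluating `t` on `q` and on `q z`, for `z` the square
of an element of order 4 on the next three strands, gives `f • t(1) = 0` as soon as `4 t(1) = 0`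
(`cubicPoly_smul`).

Existence. The relation `(s - α)(s - β) = 0` is `s² + γ s + γ² = 0`. Writing `s = γ g` turns it into
`g² + g + 1 = 0`, so the three Hecke algebras reduce to a single one, which has an Ocneanu trace for
every parameter (`HeckeAlg.exists_trace`). Since `s⁻¹ = -γ s - γ²`, its Markov parameters satisfy `v
= -γ u - γ²`. The element `q` becomes a multiple of 4 in this algebra (`quatSum_eq_zero`), hence
`K_∞` maps to all three Hecke algebras and to the ternary one.

Gluing. Modulo 4, `f` is the product of the three forms `v + γ u + γ²`. The differences of the `γ`
are units, so `R[u,v]/(f)` embeds in the product of the three quotients (`redLin_injective`). On a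
group element the three traces are reductions of the same `P`, so they come from a value in
`R[u,v]/(f)`. As `R` is free over `ℤ/4` on `1, j`, the restriction to `K_∞` descends to `ℤ/4`.

Finally, if `π(x) = 0` then `P` vanishes in `(ℤ/4)[u,v]/(f)`, that is `P = A f + 4 B`, which kills
`t(1)`. Specializing `1` to `t(1)` in the universal trace yields `t'`. -/

lemma sGen_comm {i j : ℕ} (h : i + 2 ≤ j) : sGen i * sGen j = sGen j * sGen i := by
  have := PresentedGroup.one_of_mem (rels := gammaRels)
    (x := FreeGroup.of i * FreeGroup.of j * (FreeGroup.of j * FreeGroup.of i)⁻¹)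
    (Or.inl (Or.inl ⟨i, j, h, rfl⟩))
  rw [map_mul, map_inv, mul_inv_eq_one, map_mul, map_mul] at this
  exact this

lemma sGen_braid (i : ℕ) :
    sGen i * sGen (i + 1) * sGen i = sGen (i + 1) * sGen i * sGen (i + 1) := by
  have := PresentedGroup.one_of_mem (rels := gammaRels)
    (x := FreeGroup.of i * FreeGroup.of (i + 1) * FreeGroup.of i *
      (FreeGroup.of (i + 1) * FreeGroup.of i * FreeGroup.of (i + 1))⁻¹)
    (Or.inl (Or.inr ⟨i, rfl⟩))
  rw [map_mul, map_inv, mul_inv_eq_one, map_mul, map_mul, map_mul, map_mul] at this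
  exact this

lemma braid_pow_three {G : Type*} [Group G] {a b : G} (h : a * b * a = b * a * b)
    (ha : a ^ 3 = 1) : b ^ 3 = 1 := by
  have : b = (a * b) * a * (a * b)⁻¹ := by
    rw [eq_mul_inv_iff_mul_eq, ← mul_assoc, ← h]
  rw [this, conj_pow, ha, mul_one, mul_inv_cancel]

lemma sGen_pow_three (i : ℕ) : sGen i ^ 3 = 1 := by
  induction i with
  | zero =>
    have := PresentedGroup.one_of_mem (rels := gammaRels) (x := FreeGroup.of 0 ^ 3) (Or.inr rfl)
    rw [map_pow] at this
    exact this
  | succ i ih => exact braid_pow_three (sGen_braid i) ih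

lemma sGen_inv (i : ℕ) : (sGen i)⁻¹ = sGen i ^ 2 := by
  rw [inv_eq_iff_mul_eq_one, ← pow_succ', sGen_pow_three]

/-- The morphism out of `Γ_∞` given by a family satisfying its relations. -/
def gammaLift {G : Type*} [Group G] (f : ℕ → G)
    (hc : ∀ i j, i + 2 ≤ j → f i * f j = f j * f i)
    (hb : ∀ i, f i * f (i + 1) * f i = f (i + 1) * f i * f (i + 1))
    (h3 : f 0 ^ 3 = 1) : GammaInf →* G :=
  PresentedGroup.toGroup (f := f) (by
    rintro r ((⟨i, j, h, rfl⟩ | ⟨i, rfl⟩) | rfl)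
    · simp [hc i j h]
    · simp [hb i]
    · simp [h3])

@[simp]
lemma gammaLift_sGen {G : Type*} [Group G] (f : ℕ → G) (hc hb h3) (i : ℕ) :
    gammaLift f hc hb h3 (sGen i) = f i :=
  PresentedGroup.toGroup.of _

lemma closure_range_sGen : Subgroup.closure (Set.range sGen) = ⊤ :=
  PresentedGroup.closure_range_of _

lemma sGen_mem_strands {i n : ℕ} (h : i < n) : sGen i ∈ strands n :=
  Subgroup.subset_closure ⟨i, h, rfl⟩

lemma strands_mono : Monotone strands := fun _ _ h =>
  Subgroup.closure_mono (Set.image_mono fun _ hi => lt_of_lt_of_le hi h)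

lemma exists_mem_strands (g : GammaInf) : ∃ n, g ∈ strands n := by
  have hg : g ∈ Subgroup.closure (Set.range sGen) := closure_range_sGen ▸ Subgroup.mem_top g
  induction hg using Subgroup.closure_induction with
  | mem x hx =>
    obtain ⟨i, rfl⟩ := hx
    exact ⟨i + 1, sGen_mem_strands i.lt_succ_self⟩
  | one => exact ⟨0, one_mem _⟩
  | mul x y _ _ hx hy =>
    obtain ⟨n, hn⟩ := hx
    obtain ⟨m, hm⟩ := hy
    exact ⟨max n m, mul_mem (strands_mono (le_max_left _ _) hn) (strands_mono (le_max_right _ _) hm)⟩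
  | inv x _ hx =>
    obtain ⟨n, hn⟩ := hx
    exact ⟨n, inv_mem hn⟩

lemma strands_zero : strands 0 = ⊥ := by simp [strands]

/-- Elements of `Γ_{n+1}` are products of the generators, no inverses being needed. -/
lemma strands_induction {n : ℕ} {p : ∀ g : GammaInf, g ∈ strands n → Prop}
    (one : p 1 (one_mem _))
    (mul : ∀ i (hi : i < n), ∀ g hg, p g hg → p (sGen i * g) (mul_mem (sGen_mem_strands hi) hg))
    {g : GammaInf} (hg : g ∈ strands n) : p g hg := by
  induction hg using Subgroup.closure_induction_left with
  | one => exact one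
  | mul_left x hx y hy' hy =>
    obtain ⟨i, hi, rfl⟩ := hx
    exact mul i hi y hy' hy
  | inv_mul_cancel x hx y hy' hy =>
    obtain ⟨i, hi, rfl⟩ := hx
    have := mul i hi _ _ (mul i hi y hy' hy)
    simp only [sGen_inv, pow_two, mul_assoc]
    exact this

/-- Consecutive pairs of generators are conjugate. -/
lemma exists_conj_pair (n : ℕ) : ∃ g : GammaInf,
    g * sGen 0 * g⁻¹ = sGen n ∧ g * sGen 1 * g⁻¹ = sGen (n + 1) := by
  induction n with
  | zero => exact ⟨1, by simp, by simp⟩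
  | succ n ih =>
    obtain ⟨g, h0, h1⟩ := ih
    have hab := sGen_braid n
    have hbc := sGen_braid (n + 1)
    have hac := sGen_comm (le_refl (n + 2))
    generalize sGen n = a at *
    generalize sGen (n + 1 + 1) = c at *
    generalize sGen (n + 1) = b at *
    -- Conjugation by `a b c` sends `a` to `b` and `b` to `c`.
    refine ⟨a * b * c * g, ?_, ?_⟩
    · rw [show a * b * c * g * sGen 0 * (a * b * c * g)⁻¹ =
        a * b * c * (g * sGen 0 * g⁻¹) * (a * b * c)⁻¹ by group, h0, mul_inv_eq_iff_eq_mul]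
      calc a * b * c * a = a * b * (c * a) := by group
        _ = (a * b * a) * c := by rw [← hac]; group
        _ = b * (a * b * c) := by rw [hab]; group
    · rw [show a * b * c * g * sGen 1 * (a * b * c * g)⁻¹ =
        a * b * c * (g * sGen 1 * g⁻¹) * (a * b * c)⁻¹ by group, h1, mul_inv_eq_iff_eq_mul]
      calc a * b * c * b = a * (b * c * b) := by group
        _ = (a * c) * b * c := by rw [hbc]; group
        _ = c * (a * b * c) := by rw [hac]; group

end

noncomputable section

/-! ### The Hecke algebra with quadratic relation `s ^ 2 + s + 1 = 0` -/

/-- The braid relations on infinitely many strands, with `s ^ 2 + s + 1 = 0`. -/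
structure HeckeRelations {B : Type*} [Ring B] (f : ℕ → B) : Prop where
  comm : ∀ i j, i + 2 ≤ j → f i * f j = f j * f i
  braid : ∀ i, f i * f (i + 1) * f i = f (i + 1) * f i * f (i + 1)
  quad : ∀ i, f i * f i = -f i - 1

namespace HeckeRelations

lemma pow_three {B : Type*} [Ring B] {f : ℕ → B} (hf : HeckeRelations f) (i : ℕ) :
    f i ^ 3 = 1 := by
  rw [pow_succ', pow_two, hf.quad, mul_sub, mul_neg, hf.quad, mul_one]; abel

end HeckeRelations

variable (A : Type) [CommRing A]

/-- The relations of the Hecke algebra on the free algebra. -/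
inductive HeckeRel : FreeAlgebra A ℕ → FreeAlgebra A ℕ → Prop
  | comm (i j : ℕ) (h : i + 2 ≤ j) : HeckeRel
      (FreeAlgebra.ι A i * FreeAlgebra.ι A j) (FreeAlgebra.ι A j * FreeAlgebra.ι A i)
  | braid (i : ℕ) : HeckeRel
      (FreeAlgebra.ι A i * FreeAlgebra.ι A (i + 1) * FreeAlgebra.ι A i)
      (FreeAlgebra.ι A (i + 1) * FreeAlgebra.ι A i * FreeAlgebra.ι A (i + 1))
  | quad (i : ℕ) : HeckeRel (FreeAlgebra.ι A i * FreeAlgebra.ι A i) (-FreeAlgebra.ι A i - 1)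

/-- The Hecke algebra over `A` on infinitely many strands, with `s ^ 2 + s + 1 = 0`. -/
def HeckeAlg : Type := RingQuot (HeckeRel A)

instance : Ring (HeckeAlg A) := inferInstanceAs (Ring (RingQuot (HeckeRel A)))

instance : Algebra A (HeckeAlg A) := inferInstanceAs (Algebra A (RingQuot (HeckeRel A)))

namespace HeckeAlg

/-- The generators of the Hecke algebra. -/
def gen (i : ℕ) : HeckeAlg A := RingQuot.mkAlgHom A (HeckeRel A) (FreeAlgebra.ι A i)

lemma relations : HeckeRelations (gen A) where
  comm i j h := by
    have := RingQuot.mkAlgHom_rel A (HeckeRel.comm (A := A) i j h)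
    rwa [map_mul, map_mul] at this
  braid i := by
    have := RingQuot.mkAlgHom_rel A (HeckeRel.braid (A := A) i)
    rwa [map_mul, map_mul, map_mul, map_mul] at this
  quad i := by
    have := RingQuot.mkAlgHom_rel A (HeckeRel.quad (A := A) i)
    rwa [map_mul, map_sub, map_neg, map_one] at this

variable {A}

/-- The universal property of the Hecke algebra. -/
def lift {B : Type*} [Ring B] [Algebra A B] (f : ℕ → B) (hf : HeckeRelations f) :
    HeckeAlg A →ₐ[A] B :=
  RingQuot.liftAlgHom A ⟨FreeAlgebra.lift A f, by
    rintro _ _ (⟨i, j, h⟩ | i | i)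
    · simpa using hf.comm i j h
    · simpa using hf.braid i
    · simpa using hf.quad i⟩

@[simp]
lemma lift_gen {B : Type*} [Ring B] [Algebra A B] (f : ℕ → B) (hf : HeckeRelations f) (i : ℕ) :
    lift f hf (gen A i) = f i := by
  unfold lift gen
  erw [RingQuot.liftAlgHom_mkAlgHom_apply]
  simp

variable (A) in
lemma adjoin_gen : Algebra.adjoin A (Set.range (gen A)) = ⊤ := by
  have h1 : Set.range (gen A) = RingQuot.mkAlgHom A (HeckeRel A) '' Set.range (FreeAlgebra.ι A) := by
    rw [← Set.range_comp]; rfl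
  rw [h1]
  erw [← AlgHom.map_adjoin, FreeAlgebra.adjoin_range_ι, Algebra.map_top]
  exact (AlgHom.range_eq_top _).2 (RingQuot.mkAlgHom_surjective A (HeckeRel A))

/-- Products of generators span the Hecke algebra. -/
lemma induction_mul {p : HeckeAlg A → Prop} (one : p 1) (add : ∀ x y, p x → p y → p (x + y))
    (smul : ∀ (a : A) x, p x → p (a • x)) (mul : ∀ i x, p x → p (gen A i * x))
    (x : HeckeAlg A) : p x := by
  have key : ∀ x, (∀ y, p y → p (x * y)) := fun x => by
    have hx : x ∈ Algebra.adjoin A (Set.range (gen A)) := adjoin_gen A ▸ Algebra.mem_top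
    induction hx using Algebra.adjoin_induction with
    | mem x hx => obtain ⟨i, rfl⟩ := hx; exact mul i
    | algebraMap r => intro y hy; rw [← Algebra.smul_def]; exact smul r y hy
    | add x y _ _ hx hy => intro z hz; rw [add_mul]; exact add _ _ (hx z hz) (hy z hz)
    | mul x y _ _ hx hy => intro z hz; rw [mul_assoc]; exact hx _ (hy z hz)
  simpa using key x 1 one

/-- The shift endomorphism. -/
def sh : HeckeAlg A →ₐ[A] HeckeAlg A :=
  lift (fun i => gen A (i + 1))
    { comm := fun i j h => (relations A).comm _ _ (by omega)
      braid := fun i => (relations A).braid _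
      quad := fun i => (relations A).quad _ }

@[simp]
lemma sh_gen (i : ℕ) : sh (gen A i) = gen A (i + 1) := lift_gen _ _ i

/-! ### The regular representation, induced from the shifted algebra -/

/-- The regular module, decomposed along the products `s_k ⋯ s_1`. -/
abbrev Reg (A : Type) [CommRing A] : Type := ℕ →₀ HeckeAlg A

/-- The action of a generator on a summand of the regular module. -/
def actOn (i k : ℕ) : HeckeAlg A →ₗ[A] Reg A :=
  -- The cases compute `gen i` times `s_k ⋯ s_1`: it lengthens the product; it meets an equal first
  -- factor, and the quadratic relation applies; it commutes with the whole product and is the shift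
  -- of `gen (i - 1)`; or it slides through by a braid relation and comes out as the shift of `gen
  -- i`.
  if i = k then Finsupp.lsingle (k + 1)
  else if i + 1 = k then -Finsupp.lsingle k - Finsupp.lsingle i
  else if k < i then Finsupp.lsingle k ∘ₗ LinearMap.mulLeft A (gen A (i - 1))
  else Finsupp.lsingle k ∘ₗ LinearMap.mulLeft A (gen A i)

/-- The action of a generator on the regular module. -/
def act (i : ℕ) : Module.End A (Reg A) := Finsupp.lsum A (actOn i)

lemma act_single_self (i : ℕ) (h : HeckeAlg A) :
    act i (Finsupp.single i h) = Finsupp.single (i + 1) h := by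
  simp [act, actOn]

lemma act_single_succ (i : ℕ) (h : HeckeAlg A) :
    act i (Finsupp.single (i + 1) h) = -Finsupp.single (i + 1) h - Finsupp.single i h := by
  simp [act, actOn]

lemma act_single_gt {i k : ℕ} (hk : i + 1 < k) (h : HeckeAlg A) :
    act i (Finsupp.single k h) = Finsupp.single k (gen A i * h) := by
  simp [act, actOn, show i ≠ k by omega, show i + 1 ≠ k by omega, show ¬ k < i by omega]

lemma act_succ_single_le {i k : ℕ} (hk : k ≤ i) (h : HeckeAlg A) :
    act (i + 1) (Finsupp.single k h) = Finsupp.single k (gen A i * h) := by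
  simp [act, actOn, show i + 1 ≠ k by omega, show i + 1 + 1 ≠ k by omega, hk]

lemma reg_end_ext {F G : Module.End A (Reg A)}
    (h : ∀ k x, F (Finsupp.single k x) = G (Finsupp.single k x)) : F = G :=
  Finsupp.lhom_ext h

/-- The relations are checked on the explicit model, according to the position of `k`. This makes
coordinates well defined on the presented algebra without any basis being known beforehand. -/
lemma act_relations : HeckeRelations (act (A := A)) where
  quad i := by
    refine reg_end_ext fun k x => ?_
    simp only [Module.End.mul_apply, LinearMap.sub_apply, LinearMap.neg_apply,
      Module.End.one_apply]
    rcases lt_trichotomy k i with hk | rfl | hk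
    · obtain ⟨i, rfl⟩ := Nat.exists_eq_succ_of_ne_zero (show i ≠ 0 by omega)
      rw [Nat.succ_eq_add_one, act_succ_single_le (by omega), act_succ_single_le (by omega),
        ← mul_assoc, (relations A).quad, sub_mul, neg_mul, one_mul, Finsupp.single_sub,
        Finsupp.single_neg]
    · rw [act_single_self, act_single_succ]
    · obtain rfl | hk := eq_or_lt_of_le (Nat.succ_le_of_lt hk)
      · rw [Nat.succ_eq_add_one, act_single_succ, map_sub, map_neg, act_single_succ,
          act_single_self]
      · rw [act_single_gt hk, act_single_gt hk, ← mul_assoc, (relations A).quad, sub_mul, neg_mul,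
          one_mul, Finsupp.single_sub, Finsupp.single_neg]
  comm i j hij := by
    obtain ⟨j, rfl⟩ := Nat.exists_eq_succ_of_ne_zero (show j ≠ 0 by omega)
    rw [Nat.succ_eq_add_one] at *
    refine reg_end_ext fun k x => ?_
    simp only [Module.End.mul_apply]
    have hc : ∀ i j, i + 2 ≤ j → gen A i * (gen A j * x) = gen A j * (gen A i * x) := fun i j h => by
      rw [← mul_assoc, (relations A).comm i j h, mul_assoc]
    rcases lt_trichotomy k i with hk | rfl | hk
    · obtain ⟨i, rfl⟩ := Nat.exists_eq_succ_of_ne_zero (show i ≠ 0 by omega)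
      rw [Nat.succ_eq_add_one] at *
      rw [act_succ_single_le (by omega), act_succ_single_le (by omega),
        act_succ_single_le (by omega), act_succ_single_le (by omega), hc i j (by omega)]
    · rw [act_succ_single_le (by omega), act_single_self, act_single_self,
        act_succ_single_le (by omega)]
    · obtain rfl | hk := eq_or_lt_of_le (Nat.succ_le_of_lt hk)
      · rw [Nat.succ_eq_add_one, act_succ_single_le (by omega), act_single_succ, act_single_succ,
          map_sub, map_neg, act_succ_single_le (by omega), act_succ_single_le (by omega)]
      · rw [act_single_gt hk]
        rcases lt_trichotomy k (j + 1) with h | rfl | h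
        · rw [act_succ_single_le (by omega), act_succ_single_le (by omega), act_single_gt hk,
            hc i j (by omega)]
        · rw [act_single_self, act_single_self, act_single_gt (by omega)]
        · obtain rfl | h := eq_or_lt_of_le (Nat.succ_le_of_lt h)
          · rw [Nat.succ_eq_add_one, act_single_succ, act_single_succ, map_sub, map_neg,
              act_single_gt (by omega), act_single_gt (by omega)]
          · rw [act_single_gt (by omega), act_single_gt (by omega), act_single_gt (by omega),
              hc i (j + 1) (by omega)]
  braid i := by
    refine reg_end_ext fun k x => ?_
    simp only [Module.End.mul_apply]
    have hb : ∀ i, gen A i * (gen A (i + 1) * (gen A i * x)) =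
        gen A (i + 1) * (gen A i * (gen A (i + 1) * x)) := fun i => by
      simpa only [mul_assoc] using congrArg (· * x) ((relations A).braid i)
    rcases lt_trichotomy k i with hk | rfl | hk
    · obtain ⟨i, rfl⟩ := Nat.exists_eq_succ_of_ne_zero (show i ≠ 0 by omega)
      rw [Nat.succ_eq_add_one] at *
      rw [act_succ_single_le (by omega), act_succ_single_le (by omega),
        act_succ_single_le (by omega), act_succ_single_le (by omega),
        act_succ_single_le (by omega), act_succ_single_le (by omega), hb]
    · rw [act_single_self, act_single_self, act_single_gt (by omega),
        act_succ_single_le (by omega), act_single_self, act_single_self]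
    · obtain rfl | hk := eq_or_lt_of_le (Nat.succ_le_of_lt hk)
      · rw [Nat.succ_eq_add_one, act_single_succ, act_single_self, act_single_gt (by omega),
          map_sub, map_neg, act_single_self, act_succ_single_le (le_refl i)]
        simp only [map_sub, map_neg, act_single_self, act_single_succ,
          act_single_gt (show i + 1 < i + 1 + 1 by omega)]
      · obtain rfl | hk := eq_or_lt_of_le (Nat.succ_le_of_lt hk)
        · simp only [Nat.succ_eq_add_one]
          rw [act_single_gt (by omega)]
          simp only [act_single_succ, map_sub, map_neg, act_single_self,
            act_succ_single_le (le_refl i), act_single_gt (show i + 1 < i + 1 + 1 by omega)]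
          rw [← mul_assoc, (relations A).quad, sub_mul, neg_mul, one_mul, Finsupp.single_sub,
            Finsupp.single_neg]
          abel
        · rw [act_single_gt (by omega), act_single_gt (by omega),
            act_single_gt (by omega), act_single_gt (by omega),
            act_single_gt (by omega), act_single_gt (by omega), hb]

/-- The regular representation. -/
def reg : HeckeAlg A →ₐ[A] Module.End A (Reg A) := lift act act_relations

@[simp]
lemma reg_gen (i : ℕ) : reg (gen A i) = act i := lift_gen _ _ i

/-- Right multiplication on the regular module. -/
def rmul (b : HeckeAlg A) : Module.End A (Reg A) :=
  Finsupp.mapRange.linearMap (LinearMap.mulRight A b)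

lemma rmul_single (b : HeckeAlg A) (k : ℕ) (h : HeckeAlg A) :
    rmul b (Finsupp.single k h) = Finsupp.single k (h * b) := by
  simp [rmul]

lemma act_rmul (i : ℕ) (b : HeckeAlg A) : act i * rmul b = rmul b * act i := by
  refine reg_end_ext fun k x => ?_
  simp only [Module.End.mul_apply]
  rw [rmul_single]
  rcases lt_trichotomy k i with hk | rfl | hk
  · obtain ⟨i, rfl⟩ := Nat.exists_eq_succ_of_ne_zero (show i ≠ 0 by omega)
    rw [Nat.succ_eq_add_one, act_succ_single_le (by omega), act_succ_single_le (by omega),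
      rmul_single, mul_assoc]
  · rw [act_single_self, act_single_self, rmul_single]
  · obtain rfl | hk := eq_or_lt_of_le (Nat.succ_le_of_lt hk)
    · rw [Nat.succ_eq_add_one, act_single_succ, act_single_succ, map_sub, map_neg, rmul_single,
        rmul_single]
    · rw [act_single_gt hk, act_single_gt hk, rmul_single, mul_assoc]

/-- The action is by left multiplications, so it commutes with right multiplication on each summand.
This is what makes `coord` linear over the shifted algebra on the right. -/
lemma reg_rmul (x b : HeckeAlg A) (f : Reg A) : reg x (rmul b f) = rmul b (reg x f) := by
  induction x using induction_mul generalizing f with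
  | one => simp
  | add x y hx hy => simp [hx, hy]
  | smul a x hx => simp [hx]
  | mul i x hx =>
    rw [map_mul, Module.End.mul_apply, Module.End.mul_apply, hx, reg_gen, ← Module.End.mul_apply,
      act_rmul, Module.End.mul_apply]

/-- The coordinates of an element of the Hecke algebra. -/
def coord : HeckeAlg A →ₗ[A] Reg A := (LinearMap.applyₗ (Finsupp.single 0 1)) ∘ₗ reg.toLinearMap

lemma coord_apply (x : HeckeAlg A) : coord x = reg x (Finsupp.single 0 1) := rfl

lemma coord_gen_mul (i : ℕ) (x : HeckeAlg A) : coord (gen A i * x) = act i (coord x) := by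
  simp [coord_apply]

lemma coord_sh (b : HeckeAlg A) : coord (sh b) = Finsupp.single 0 b := by
  induction b using induction_mul with
  | one => simp [coord_apply]
  | add x y hx hy => simp [hx, hy, Finsupp.single_add]
  | smul a x hx => simp [hx]
  | mul i x hx =>
    rw [map_mul, sh_gen, coord_gen_mul, hx, act_succ_single_le (by omega)]

lemma coord_mul_sh (x b : HeckeAlg A) : coord (x * sh b) = rmul b (coord x) := by
  rw [coord_apply, map_mul, Module.End.mul_apply, ← coord_apply (sh b), coord_sh, coord_apply,
    ← reg_rmul, rmul_single, one_mul]

end HeckeAlg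

end

noncomputable section

namespace HeckeAlg

variable {A : Type} [CommRing A]

/-! ### Decomposition of the regular module -/

variable (A) in
/-- The product `s_k ⋯ s_1`. -/
def descProd : ℕ → HeckeAlg A
  | 0 => 1
  | k + 1 => gen A k * descProd k

lemma gen_mul_descProd_of_lt {k j : ℕ} (h : k < j) :
    gen A j * descProd A k = descProd A k * gen A j := by
  induction k with
  | zero => simp [descProd]
  | succ k ih =>
    rw [descProd, ← mul_assoc, ← (relations A).comm k j (by omega), mul_assoc, ih (by omega),
      mul_assoc]

lemma gen_mul_descProd_of_gt {i k : ℕ} (h : i + 1 < k) :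
    gen A i * descProd A k = descProd A k * gen A (i + 1) := by
  induction k with
  | zero => omega
  | succ k ih =>
    obtain rfl | hk := eq_or_lt_of_le (Nat.le_of_lt_succ h)
    · simp only [descProd, mul_assoc]
      rw [← gen_mul_descProd_of_lt (Nat.lt_succ_self i)]
      simpa only [mul_assoc] using congrArg (· * descProd A i) ((relations A).braid i)
    · rw [descProd, ← mul_assoc, (relations A).comm i k (by omega), mul_assoc, ih hk, mul_assoc]

lemma sh_descProd_mul (k : ℕ) : sh (descProd A k) * gen A 0 = descProd A (k + 1) := by
  induction k with
  | zero => simp [descProd]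
  | succ k ih => rw [descProd, map_mul, sh_gen, mul_assoc, ih]; rfl

/-- Recovers an element from its coordinates. -/
def ofCoord : Reg A →ₗ[A] HeckeAlg A :=
  Finsupp.lsum A fun k => LinearMap.mulLeft A (descProd A k) ∘ₗ sh.toLinearMap

lemma ofCoord_single (k : ℕ) (h : HeckeAlg A) :
    ofCoord (Finsupp.single k h) = descProd A k * sh h := by
  simp [ofCoord]

lemma ofCoord_act (i : ℕ) (f : Reg A) : ofCoord (act i f) = gen A i * ofCoord f := by
  induction f using Finsupp.induction_linear with
  | zero => simp
  | add f g hf hg => simp only [map_add, hf, hg, mul_add]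
  | single k x =>
    rcases lt_trichotomy k i with hk | rfl | hk
    · obtain ⟨i, rfl⟩ := Nat.exists_eq_succ_of_ne_zero (show i ≠ 0 by omega)
      rw [Nat.succ_eq_add_one, act_succ_single_le (by omega), ofCoord_single, ofCoord_single,
        map_mul, sh_gen, ← mul_assoc, ← mul_assoc, gen_mul_descProd_of_lt hk]
    · rw [act_single_self, ofCoord_single, ofCoord_single, descProd, mul_assoc]
    · obtain rfl | hk := eq_or_lt_of_le (Nat.succ_le_of_lt hk)
      · rw [Nat.succ_eq_add_one, act_single_succ, map_sub, map_neg, ofCoord_single, ofCoord_single,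
          descProd, ← mul_assoc, ← mul_assoc, (relations A).quad]
        noncomm_ring
      · rw [act_single_gt hk, ofCoord_single, ofCoord_single, map_mul, sh_gen, ← mul_assoc,
          ← mul_assoc, gen_mul_descProd_of_gt hk]

lemma ofCoord_coord (x : HeckeAlg A) : ofCoord (coord x) = x := by
  induction x using induction_mul with
  | one => simp [coord_apply, ofCoord_single, descProd]
  | add x y hx hy => simp only [map_add, hx, hy]
  | smul a x hx => simp only [map_smul, hx]
  | mul i x hx => rw [coord_gen_mul, ofCoord_act, hx]

/-- The Hecke algebra is `sh H + sh H s_1 sh H`. -/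
lemma induction_sh {p : HeckeAlg A → Prop} (add : ∀ x y, p x → p y → p (x + y))
    (base : ∀ b, p (sh b)) (step : ∀ b c, p (sh b * gen A 0 * sh c)) (x : HeckeAlg A) : p x := by
  rw [← ofCoord_coord x]
  induction coord x using Finsupp.induction_linear with
  | zero => simpa using base 0
  | add f g hf hg => rw [map_add]; exact add _ _ hf hg
  | single k h =>
    rw [ofCoord_single]
    cases k with
    | zero => simpa [descProd] using base h
    -- Only the last factor `gen 0` of `s_{k+1} ⋯ s_1` lies outside the shifted algebra.
    | succ k => rw [← sh_descProd_mul]; exact step _ _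

/-! ### The conditional expectation onto the shifted algebra -/

/-- The values of the conditional expectation on the products `s_k ⋯ s_1`. -/
def expProd (u : A) : ℕ → HeckeAlg A
  | 0 => 1
  | k + 1 => u • descProd A k

/-- The conditional expectation in terms of coordinates. -/
def expCoord (u : A) : Reg A →ₗ[A] HeckeAlg A :=
  Finsupp.lsum A fun k => LinearMap.mulLeft A (expProd u k)

lemma expCoord_single (u : A) (k : ℕ) (h : HeckeAlg A) :
    expCoord u (Finsupp.single k h) = expProd u k * h := by
  simp [expCoord]

/-- Left linearity over the shifted algebra: on the summand `k + 1`, the rules for `act (i + 1)` are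
those for `gen i` acting on `s_k ⋯ s_1`. Together with `expCoord_rmul` this makes `condExp` a
bimodule map removing the first strand. -/
lemma expCoord_act (u : A) (i : ℕ) (f : Reg A) :
    expCoord u (act (i + 1) f) = gen A i * expCoord u f := by
  induction f using Finsupp.induction_linear with
  | zero => simp
  | add f g hf hg => simp only [map_add, hf, hg, mul_add]
  | single k x =>
    rcases Nat.lt_or_ge i k with hk | hk
    · obtain ⟨k, rfl⟩ := Nat.exists_eq_succ_of_ne_zero (show k ≠ 0 by omega)
      rw [Nat.succ_eq_add_one] at *
      obtain rfl | hk := eq_or_lt_of_le (Nat.le_of_lt_succ hk)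
      · rw [act_single_self, expCoord_single, expCoord_single, expProd, expProd, descProd]
        simp only [smul_mul_assoc, mul_smul_comm, mul_assoc]
      · obtain rfl | hk := eq_or_lt_of_le (Nat.succ_le_of_lt hk)
        · rw [Nat.succ_eq_add_one, act_single_succ, map_sub, map_neg, expCoord_single,
            expCoord_single, expProd, expProd, descProd]
          simp only [smul_mul_assoc, mul_smul_comm]
          rw [← mul_assoc, ← mul_assoc, (relations A).quad, ← smul_neg, ← smul_sub]
          congr 1
          noncomm_ring
        · rw [act_single_gt (by omega), expCoord_single, expCoord_single, expProd]
          simp only [smul_mul_assoc, mul_smul_comm]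
          rw [← mul_assoc, ← mul_assoc, gen_mul_descProd_of_gt hk]
    · rw [act_succ_single_le hk, expCoord_single, expCoord_single, ← mul_assoc, ← mul_assoc]
      congr 1
      cases k with
      | zero => simp [expProd]
      | succ k =>
        rw [expProd, mul_smul_comm, smul_mul_assoc, gen_mul_descProd_of_lt (by omega)]

lemma expCoord_rmul (u : A) (b : HeckeAlg A) (f : Reg A) :
    expCoord u (rmul b f) = expCoord u f * b := by
  induction f using Finsupp.induction_linear with
  | zero => simp
  | add f g hf hg => simp only [map_add, hf, hg, add_mul]
  | single k x => rw [rmul_single, expCoord_single, expCoord_single, mul_assoc]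

/-- The conditional expectation, composed with the inverse of the shift. -/
def condExp (u : A) : HeckeAlg A →ₗ[A] HeckeAlg A := expCoord u ∘ₗ coord

lemma condExp_gen_succ_mul (u : A) (i : ℕ) (x : HeckeAlg A) :
    condExp u (gen A (i + 1) * x) = gen A i * condExp u x := by
  simp only [condExp, LinearMap.comp_apply, coord_gen_mul, expCoord_act]

lemma condExp_mul_sh (u : A) (x b : HeckeAlg A) :
    condExp u (x * sh b) = condExp u x * b := by
  simp only [condExp, LinearMap.comp_apply, coord_mul_sh, expCoord_rmul]

lemma condExp_sh_mul (u : A) (b x : HeckeAlg A) :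
    condExp u (sh b * x) = b * condExp u x := by
  induction b using induction_mul with
  | one => simp
  | add b c hb hc => simp only [map_add, add_mul, hb, hc]
  | smul a b hb => simp only [map_smul, smul_mul_assoc, hb]
  | mul i b hb => rw [map_mul sh, sh_gen, mul_assoc, condExp_gen_succ_mul, hb, mul_assoc]

@[simp]
lemma condExp_one (u : A) : condExp u (1 : HeckeAlg A) = 1 := by
  simp [condExp, coord_apply, expCoord_single, expProd]

lemma condExp_sh (u : A) (b : HeckeAlg A) : condExp u (sh b) = b := by
  simpa using condExp_mul_sh u 1 b

lemma condExp_gen_zero (u : A) : condExp u (gen A 0) = u • 1 := by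
  have : coord (gen A 0) = Finsupp.single 1 1 := by
    rw [coord_apply, reg_gen, act_single_self]
  simp [condExp, this, expCoord_single, expProd, descProd]

lemma commute_gen_zero_sh_sh (b : HeckeAlg A) :
    gen A 0 * sh (sh b) = sh (sh b) * gen A 0 := by
  induction b using induction_mul with
  | one => simp
  | add b c hb hc => simp only [map_add, add_mul, mul_add, hb, hc]
  | smul a b hb => simp only [map_smul, smul_mul_assoc, mul_smul_comm, hb]
  | mul i b hb =>
    rw [map_mul, map_mul, sh_gen, sh_gen, ← mul_assoc, (relations A).comm 0 _ (by omega),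
      mul_assoc, hb, mul_assoc]

/-- If `b` is itself shifted, it commutes with `gen 0` and the quadratic relation applies. Otherwise
`b` has one factor `gen 0`, whose shift `gen 1` stands between two `gen 0`, and the braid relation
leaves a single `gen 0` on each side of `gen 1`'s new position. -/
lemma condExp_gen_sh_gen (u : A) (b : HeckeAlg A) :
    condExp u (gen A 0 * sh b * gen A 0) = -(u • b) - sh (condExp u b) := by
  induction b using induction_sh with
  | add b c hb hc =>
    simp only [map_add, mul_add, add_mul, hb, hc, smul_add]
    abel
  | base b =>
    rw [commute_gen_zero_sh_sh, mul_assoc, (relations A).quad, condExp_sh_mul, map_sub, map_neg,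
      condExp_gen_zero, condExp_one, condExp_sh, mul_sub, mul_neg, mul_smul_comm, mul_one]
  | step b c =>
    have h1 : gen A 0 * sh (sh b * gen A 0 * sh c) * gen A 0 =
        sh (sh b * gen A 0) * (gen A 0 * sh (gen A 0 * sh c)) := by
      simp only [map_mul, sh_gen, zero_add]
      have := (relations A).braid 0
      rw [zero_add] at this
      calc gen A 0 * (sh (sh b) * gen A 1 * sh (sh c)) * gen A 0
          = (gen A 0 * sh (sh b)) * gen A 1 * (sh (sh c) * gen A 0) := by noncomm_ring
        _ = sh (sh b) * (gen A 0 * gen A 1 * gen A 0) * sh (sh c) := by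
            rw [commute_gen_zero_sh_sh, ← commute_gen_zero_sh_sh c]; noncomm_ring
        _ = _ := by rw [this]; noncomm_ring
    rw [h1, condExp_sh_mul, condExp_mul_sh, condExp_gen_zero, condExp_mul_sh, condExp_sh_mul,
      condExp_gen_zero]
    simp only [smul_mul_assoc, mul_smul_comm, one_mul, mul_one, map_smul, map_mul]
    rw [show sh b * gen A 0 * (gen A 0 * sh c) = sh b * (gen A 0 * gen A 0) * sh c by noncomm_ring,
      (relations A).quad, ← smul_neg, ← smul_sub]
    congr 1
    noncomm_ring

/-- This is the heart of the trace property. Write `E` for `condExp u`. For `x = sh b * gen 0 * sh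
c`, both sides equal `-u E(b c) - E(b) E(c)` by `condExp_gen_sh_gen` and the bimodule property. -/
lemma condExp_condExp_comm (u : A) (x : HeckeAlg A) :
    condExp u (condExp u (gen A 0 * x)) = condExp u (condExp u (x * gen A 0)) := by
  induction x using induction_sh with
  | add x y hx hy => simp only [mul_add, add_mul, map_add, hx, hy]
  | base b => rw [condExp_mul_sh, condExp_sh_mul, condExp_gen_zero]; simp
  | step b c =>
    rw [← mul_assoc, ← mul_assoc, condExp_mul_sh, condExp_gen_sh_gen, mul_assoc, mul_assoc,
      condExp_sh_mul, ← mul_assoc, condExp_gen_sh_gen, sub_mul, mul_sub, map_sub, map_sub,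
      condExp_sh_mul, condExp_mul_sh]
    simp

/-! ### The Ocneanu trace -/

variable (A) in
/-- The subalgebra generated by the first `n` generators. -/
def sub (n : ℕ) : Subalgebra A (HeckeAlg A) := Algebra.adjoin A (gen A '' {i | i < n})

lemma gen_mem_sub {i n : ℕ} (h : i < n) : gen A i ∈ sub A n :=
  Algebra.subset_adjoin ⟨i, h, rfl⟩

lemma sub_mono : Monotone (sub A) := fun _ _ h =>
  Algebra.adjoin_mono (Set.image_mono fun _ hi => lt_of_lt_of_le hi h)

lemma exists_mem_sub (x : HeckeAlg A) : ∃ n, x ∈ sub A n := by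
  induction x using induction_mul with
  | one => exact ⟨0, one_mem _⟩
  | add x y hx hy =>
    obtain ⟨n, hn⟩ := hx
    obtain ⟨m, hm⟩ := hy
    exact ⟨max n m, add_mem (sub_mono (le_max_left _ _) hn) (sub_mono (le_max_right _ _) hm)⟩
  | smul a x hx =>
    obtain ⟨n, hn⟩ := hx
    exact ⟨n, Subalgebra.smul_mem _ hn a⟩
  | mul i x hx =>
    obtain ⟨n, hn⟩ := hx
    exact ⟨max n (i + 1), mul_mem (gen_mem_sub (by omega)) (sub_mono (le_max_left _ _) hn)⟩

lemma descProd_mem_sub {k n : ℕ} (h : k ≤ n) : descProd A k ∈ sub A n := by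
  induction k with
  | zero => exact one_mem _
  | succ k ih => exact mul_mem (gen_mem_sub h) (ih (by omega))

lemma sub_induction {n : ℕ} {p : HeckeAlg A → Prop} (one : p 1)
    (add : ∀ x y, p x → p y → p (x + y)) (smul : ∀ (a : A) x, p x → p (a • x))
    (mul : ∀ i < n, ∀ x, p x → p (gen A i * x)) {x : HeckeAlg A} (hx : x ∈ sub A n) : p x := by
  have key : ∀ y, p y → p (x * y) := by
    unfold sub at hx
    induction hx using Algebra.adjoin_induction with
    | mem x hx => obtain ⟨i, hi, rfl⟩ := hx; exact mul i hi
    | algebraMap r => intro y hy; rw [← Algebra.smul_def]; exact smul r y hy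
    | add x y _ _ hx hy => intro z hz; rw [add_mul]; exact add _ _ (hx z hz) (hy z hz)
    | mul x y _ _ hx hy => intro z hz; rw [mul_assoc]; exact hx _ (hy z hz)
  simpa using key 1 one

variable (A) in
/-- The coordinates of the elements of the subalgebra generated by `n + 1` generators. -/
def subReg (n : ℕ) : Submodule A (Reg A) :=
  Submodule.span A {f | ∃ k ≤ n + 1, ∃ h ∈ sub A n, f = Finsupp.single k h}

lemma single_mem_subReg {n k : ℕ} (hk : k ≤ n + 1) {h : HeckeAlg A} (hh : h ∈ sub A n) :
    Finsupp.single k h ∈ subReg A n :=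
  Submodule.subset_span ⟨k, hk, h, hh, rfl⟩

lemma act_mem_subReg {i n : ℕ} (hi : i ≤ n) {f : Reg A} (hf : f ∈ subReg A n) :
    act i f ∈ subReg A n := by
  unfold subReg at hf
  induction hf using Submodule.span_induction with
  | zero => simp
  | add f g _ _ hf hg => rw [map_add]; exact add_mem hf hg
  | smul a f _ hf => rw [map_smul]; exact Submodule.smul_mem _ a hf
  | mem f hf =>
    obtain ⟨k, hk, x, hx, rfl⟩ := hf
    rcases lt_trichotomy k i with h | rfl | h
    · obtain ⟨i, rfl⟩ := Nat.exists_eq_succ_of_ne_zero (show i ≠ 0 by omega)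
      rw [Nat.succ_eq_add_one, act_succ_single_le (by omega)]
      exact single_mem_subReg hk (mul_mem (gen_mem_sub (by omega)) hx)
    · rw [act_single_self]
      exact single_mem_subReg (by omega) hx
    · obtain rfl | h := eq_or_lt_of_le (Nat.succ_le_of_lt h)
      · rw [Nat.succ_eq_add_one, act_single_succ]
        exact sub_mem (neg_mem (single_mem_subReg hk hx)) (single_mem_subReg (by omega) hx)
      · rw [act_single_gt h]
        exact single_mem_subReg hk (mul_mem (gen_mem_sub (by omega)) hx)

lemma coord_mem_subReg {n : ℕ} {x : HeckeAlg A} (hx : x ∈ sub A (n + 1)) :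
    coord x ∈ subReg A n := by
  refine sub_induction (p := fun x => coord x ∈ subReg A n) ?_ (fun x y hx hy => ?_)
    (fun a x hx => ?_) (fun i hi x hx => ?_) hx
  · rw [coord_apply, map_one]
    exact single_mem_subReg (by omega) (one_mem _)
  · rw [map_add]; exact add_mem hx hy
  · rw [map_smul]; exact Submodule.smul_mem _ a hx
  · rw [coord_gen_mul]; exact act_mem_subReg (by omega) hx

/-- Elements in `n + 1` generators only have coordinates `k ≤ n + 1`, with entries in `n`
generators; the expectation also shortens `s_k ⋯ s_1` by one factor. -/
lemma condExp_mem_sub (u : A) {n : ℕ} {x : HeckeAlg A} (hx : x ∈ sub A (n + 1)) :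
    condExp u x ∈ sub A n := by
  have : subReg A n ≤ (Subalgebra.toSubmodule (sub A n)).comap (expCoord u) := by
    refine Submodule.span_le.2 ?_
    rintro _ ⟨k, hk, h, hh, rfl⟩
    rw [SetLike.mem_coe, Submodule.mem_comap, expCoord_single, Subalgebra.mem_toSubmodule]
    refine mul_mem ?_ hh
    cases k with
    | zero => exact one_mem _
    | succ k => exact Subalgebra.smul_mem _ (descProd_mem_sub (by omega)) u
  exact this (coord_mem_subReg hx)

lemma mem_sub_zero {x : HeckeAlg A} : x ∈ sub A 0 ↔ ∃ c : A, x = c • 1 := by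
  simp [sub, Algebra.mem_bot, Algebra.algebraMap_eq_smul_one, eq_comm]

/-- Each application uses up one generator, so `n` of them reach the scalars, which further
applications fix. The value therefore does not depend on the number of iterations once it is large
enough. -/
lemma condExp_pow_eq (u : A) {n : ℕ} {x : HeckeAlg A} (hx : x ∈ sub A n) :
    ∃ c : A, ∀ m, n ≤ m → (condExp u ^ m) x = c • 1 := by
  induction n generalizing x with
  | zero =>
    obtain ⟨c, rfl⟩ := mem_sub_zero.1 hx
    refine ⟨c, fun m _ => ?_⟩
    induction m with
    | zero => simp
    | succ m ih => rw [pow_succ, Module.End.mul_apply, map_smul, condExp_one, ih (Nat.zero_le _)]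
  | succ n ih =>
    obtain ⟨c, hc⟩ := ih (condExp_mem_sub u hx)
    refine ⟨c, fun m hm => ?_⟩
    obtain ⟨m, rfl⟩ := Nat.exists_eq_succ_of_ne_zero (show m ≠ 0 by omega)
    rw [Nat.succ_eq_add_one, pow_succ, Module.End.mul_apply, hc m (by omega)]

/-- The bimodule property lowers the index of the generator at each application, down to `gen 0`,
where two more applications suffice. -/
lemma condExp_pow_comm (u : A) (i m : ℕ) (x : HeckeAlg A) :
    (condExp u ^ (i + 2 + m)) (gen A i * x) = (condExp u ^ (i + 2 + m)) (x * gen A i) := by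
  induction i generalizing x with
  | zero =>
    rw [zero_add, add_comm, pow_add, Module.End.mul_apply, Module.End.mul_apply, pow_two,
      Module.End.mul_apply, Module.End.mul_apply, condExp_condExp_comm]
  | succ i ih =>
    rw [show i + 1 + 2 + m = i + 2 + m + 1 by omega, pow_succ, Module.End.mul_apply,
      Module.End.mul_apply, condExp_gen_succ_mul, ih, ← sh_gen, condExp_mul_sh]

lemma condExp_pow_mul_gen (u : A) (n : ℕ) (x : HeckeAlg A) :
    (condExp u ^ n) (x * gen A n) = (condExp u ^ n) x * gen A 0 := by
  induction n generalizing x with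
  | zero => simp
  | succ n ih =>
    rw [pow_succ, Module.End.mul_apply, Module.End.mul_apply, ← sh_gen, condExp_mul_sh, ih]

/-- Existence of the Ocneanu trace, with arbitrary parameter `u`. -/
theorem exists_trace (u ω : A) (hω : ω * ω = -ω - 1) :
    ∃ τ : HeckeAlg A →ₗ[A] A, τ 1 = 1 ∧ (∀ x y, τ (x * y) = τ (y * x)) ∧
      ∀ n, ∀ x ∈ sub A n, τ (x * gen A n) = u * τ x := by
  -- The character `χ` serves only to read `c` off `c • 1`; it spares a proof that `A` embeds in the
  -- Hecke algebra. A root `ω` of the quadratic relation is needed for it.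
  let χ : HeckeAlg A →ₐ[A] A := lift (fun _ => ω) ⟨fun _ _ _ => rfl, fun _ => rfl, fun _ => hω⟩
  choose N hN using exists_mem_sub (A := A)
  have stable : ∀ n, ∀ x ∈ sub A n, χ ((condExp u ^ N x) x) = χ ((condExp u ^ n) x) := by
    intro n x hx
    obtain ⟨c, hc⟩ := condExp_pow_eq u (hN x)
    obtain ⟨d, hd⟩ := condExp_pow_eq u hx
    rw [hd n le_rfl, ← hd (max n (N x)) (le_max_left _ _), hc _ (le_max_right _ _), hc _ le_rfl]
  let τ : HeckeAlg A →ₗ[A] A :=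
    { toFun := fun x => χ ((condExp u ^ N x) x)
      map_add' := fun x y => by
        have hx := sub_mono (le_max_left (N x) (N y)) (hN x)
        have hy := sub_mono (le_max_right (N x) (N y)) (hN y)
        rw [stable _ _ (add_mem hx hy), stable _ _ hx, stable _ _ hy, map_add, map_add]
      map_smul' := fun a x => by
        rw [stable _ _ (Subalgebra.smul_mem _ (hN x) a), map_smul, map_smul, RingHom.id_apply] }
  have hτ : ∀ n, ∀ x ∈ sub A n, τ x = χ ((condExp u ^ n) x) := stable
  have hgen : ∀ i x, τ (gen A i * x) = τ (x * gen A i) := fun i x => by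
    have hi : gen A i ∈ sub A (i + 2 + N x) := gen_mem_sub (by omega)
    have hx : x ∈ sub A (i + 2 + N x) := sub_mono (by omega) (hN x)
    rw [hτ _ _ (mul_mem hi hx), hτ _ _ (mul_mem hx hi), condExp_pow_comm]
  refine ⟨τ, ?_, fun x => ?_, fun n x hx => ?_⟩
  · rw [hτ 0 1 (one_mem _), pow_zero, Module.End.one_apply, map_one]
  · induction x using induction_mul with
    | one => simp
    | add x y hx hy => intro z; rw [add_mul, mul_add, map_add, map_add, hx, hy]
    | smul a x hx => intro z; rw [smul_mul_assoc, mul_smul_comm, map_smul, map_smul, hx]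
    | mul i x hx => intro z; rw [mul_assoc, hgen, mul_assoc, hx, mul_assoc]
  -- Since `gen n` is the `n`-fold shift of `gen 0`, `n` applications turn `x * gen n` into `c • gen
  -- 0`, and one more gives `u * c`.
  · obtain ⟨c, hc⟩ := condExp_pow_eq u hx
    rw [hτ (n + 1) _ (mul_mem (sub_mono n.le_succ hx) (gen_mem_sub n.lt_succ_self)), hτ n x hx,
      pow_succ', Module.End.mul_apply, condExp_pow_mul_gen, hc n le_rfl]
    simp [condExp_gen_zero, mul_comm]

end HeckeAlg

end

noncomputable section

/-! ### The binary tetrahedral group -/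

section Quaternion

variable {G : Type*} [Group G] {a b : G}

/-- `a * b⁻¹` is the conjugate of `a * b * a` by `b⁻¹`, and the square of `a * b * a` is central in
the subgroup generated by `a` and `b`, because `a * b * a` exchanges `a` and `b` by conjugation. -/
lemma braid_mul_inv_sq (h : a * b * a = b * a * b) (hb : b ^ 3 = 1) :
    (a * b⁻¹) ^ 2 = (a * b * a) ^ 2 := by
  have hb' : b⁻¹ * b⁻¹ = b := by
    rw [← mul_inv_rev, inv_eq_iff_mul_eq_one, ← pow_two, ← pow_succ, hb]
  have h1 : a * b⁻¹ = b⁻¹ * (a * b * a) * b := by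
    calc a * b⁻¹ = b⁻¹ * (b * a * (b⁻¹ * b⁻¹)) * b := by group
      _ = _ := by rw [hb', h]
  have h2 : b⁻¹ * (a * b * a) = (a * b * a) * a⁻¹ := by
    rw [inv_mul_eq_iff_eq_mul]
    calc a * b * a = (b * a * b) * a * a⁻¹ := by rw [h]; group
      _ = _ := by group
  have h3 : a⁻¹ * (a * b * a) = (a * b * a) * b⁻¹ := by
    rw [eq_mul_inv_iff_mul_eq]
    calc a⁻¹ * (a * b * a) * b = b * a * b := by group
      _ = _ := h.symm
  calc (a * b⁻¹) ^ 2 = b⁻¹ * (a * b * a) * (a * b * a) * b := by rw [h1, pow_two]; group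
    _ = (a * b * a) ^ 2 := by
        rw [h2, mul_assoc (a * b * a), h3, pow_two]; group

lemma braid_mul_inv_sq_symm (h : a * b * a = b * a * b) (ha : a ^ 3 = 1) :
    (b * a⁻¹) ^ 2 = (a * b⁻¹) ^ 2 := by
  rw [braid_mul_inv_sq h (braid_pow_three h ha), braid_mul_inv_sq h.symm ha, h]

lemma commute_braid_sq (h : a * b * a = b * a * b) : (a * b * a) ^ 2 * b = b * (a * b * a) ^ 2 := by
  have h1 : (a * b * a) * a = b * (a * b * a) := by
    calc (a * b * a) * a = (b * a * b) * a := by rw [h]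
      _ = _ := by group
  have h2 : (a * b * a) * b = a * (a * b * a) := by
    calc (a * b * a) * b = a * (b * a * b) := by group
      _ = _ := by rw [h]
  rw [pow_two, mul_assoc, h2, ← mul_assoc, h1, mul_assoc]

/-- `b * a⁻¹ * b` is `(b * a⁻¹) ^ 2 * a`, and that square is the central element `(a * b⁻¹) ^ 2`.
The result is `a` times the last term of `q`, so that `q` can eliminate it. -/
lemma mul_inv_mul_eq (h : a * b * a = b * a * b) (ha : a ^ 3 = 1) :
    b * a⁻¹ * b = a ^ 2 * (b ^ 2 * a * b ^ 2) := by
  have hb := braid_pow_three h ha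
  have hb' : b ^ 2 = b⁻¹ := by rw [eq_inv_iff_mul_eq_one, ← pow_succ, hb]
  have ha' : a ^ 2 = a⁻¹ := by rw [eq_inv_iff_mul_eq_one, ← pow_succ, ha]
  have ha'' : a = a⁻¹ * a⁻¹ := by
    rw [← mul_inv_rev, ← pow_two, ha', inv_inv]
  have := braid_mul_inv_sq_symm h ha
  rw [pow_two, pow_two] at this
  calc b * a⁻¹ * b = (b * a⁻¹ * (b * a⁻¹)) * a := by group
    _ = a * b⁻¹ * (a * b⁻¹) * a := by rw [this]
    _ = a * (b⁻¹ * a * b⁻¹ * a) := by group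
    _ = a * (a * b⁻¹ * (a * b⁻¹)) := by
        have hc := commute_braid_sq h.symm
        rw [← h, ← braid_mul_inv_sq h hb, pow_two] at hc
        congr 1
        calc b⁻¹ * a * b⁻¹ * a = a⁻¹ * (a * b⁻¹ * (a * b⁻¹) * a) := by group
          _ = _ := by rw [hc]; group
    _ = a ^ 2 * (b ^ 2 * a * b ^ 2) := by rw [hb', pow_two]; group

end Quaternion

/-! ### The spanning property of `K_∞` -/

/-- The element `q` written on two elements. -/
def quatSum {H : Type*} [Ring H] (a b : H) : H :=
  1 + a * b ^ 2 + b * a ^ 2 + a ^ 2 * b + b ^ 2 * a + a * b * a + a ^ 2 * b ^ 2 * a ^ 2 +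
    a * b ^ 2 * a * b ^ 2

lemma quatSum_toQuot (n : ℕ) :
    quatSum (toQuot idealK (sGen n)) (toQuot idealK (sGen (n + 1))) = 0 := by
  have h0 : quatSum (toQuot idealK (sGen 0)) (toQuot idealK (sGen 1)) = 0 := by
    have h : (Ideal.Quotient.mk idealK.asIdeal) qElt = 0 :=
      Ideal.Quotient.eq_zero_iff_mem.2 (TwoSidedIdeal.subset_span rfl)
    simp only [qElt, map_add, map_mul, map_pow, map_one] at h
    exact h
  obtain ⟨g, ha, hb⟩ := exists_conj_pair n
  rw [← ha, ← hb]
  generalize sGen 0 = a at *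
  generalize sGen 1 = b at *
  generalize toQuot idealK = ρ at *
  have key : quatSum (ρ (g * a * g⁻¹)) (ρ (g * b * g⁻¹)) =
      ρ g * quatSum (ρ a) (ρ b) * ρ g⁻¹ := by
    simp only [quatSum, ← map_pow, ← map_mul, mul_add, add_mul]
    rw [mul_one, ← map_mul, mul_inv_cancel, map_one]
    simp only [conj_pow, conj_mul]
  rw [key, h0, mul_zero, zero_mul]

/-- The span of `Γ_{n+1}` and of the double cosets of `s_{n+1}` and its inverse. -/
def bispan (n : ℕ) : Submodule ℤ KInf :=
  Submodule.span ℤ (toQuot idealK '' {x | x ∈ strands n ∨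
    ∃ g ∈ strands n, ∃ h ∈ strands n, x = g * sGen n * h ∨ x = g * (sGen n)⁻¹ * h})

lemma mem_bispan {n : ℕ} {g : GammaInf} (hg : g ∈ strands n) : toQuot idealK g ∈ bispan n :=
  Submodule.subset_span ⟨g, Or.inl hg, rfl⟩

lemma gen_mem_bispan {n : ℕ} {g h : GammaInf} (hg : g ∈ strands n) (hh : h ∈ strands n) :
    toQuot idealK (g * sGen n * h) ∈ bispan n :=
  Submodule.subset_span ⟨_, Or.inr ⟨g, hg, h, hh, Or.inl rfl⟩, rfl⟩

lemma gen_inv_mem_bispan {n : ℕ} {g h : GammaInf} (hg : g ∈ strands n) (hh : h ∈ strands n) :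
    toQuot idealK (g * (sGen n)⁻¹ * h) ∈ bispan n :=
  Submodule.subset_span ⟨_, Or.inr ⟨g, hg, h, hh, Or.inr rfl⟩, rfl⟩

lemma mul_mem_bispan {n : ℕ} {g h : GammaInf} (hg : g ∈ strands n) (hh : h ∈ strands n) {x : KInf}
    (hx : x ∈ bispan n) : toQuot idealK g * x * toQuot idealK h ∈ bispan n := by
  unfold bispan at hx
  induction hx using Submodule.span_induction with
  | zero => simp
  | add x y _ _ hx hy => rw [mul_add, add_mul]; exact add_mem hx hy
  | smul c x _ hx => rw [mul_smul_comm, smul_mul_assoc]; exact Submodule.smul_mem _ c hx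
  | mem x hx =>
    obtain ⟨x, hx | ⟨g', hg', h', hh', rfl | rfl⟩, rfl⟩ := hx
    · rw [← map_mul, ← map_mul]
      exact mem_bispan (mul_mem (mul_mem hg hx) hh)
    · rw [← map_mul, ← map_mul, show g * (g' * sGen n * h') * h = g * g' * sGen n * (h' * h) by group]
      exact gen_mem_bispan (mul_mem hg hg') (mul_mem hh' hh)
    · rw [← map_mul, ← map_mul,
        show g * (g' * (sGen n)⁻¹ * h') * h = g * g' * (sGen n)⁻¹ * (h' * h) by group]
      exact gen_inv_mem_bispan (mul_mem hg hg') (mul_mem hh' hh)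

lemma commute_strands {n m : ℕ} (h : n < m) {g : GammaInf} (hg : g ∈ strands n) :
    sGen m * g = g * sGen m := by
  induction hg using strands_induction with
  | one => simp
  | mul i hi g _ ih => rw [← mul_assoc, ← sGen_comm (by omega), mul_assoc, ih, mul_assoc]

/-- The only point of the spanning argument where `q` is used. -/
lemma gen_mul_inv_mul_gen_mem_bispan (m : ℕ) :
    toQuot idealK (sGen (m + 1) * (sGen m)⁻¹ * sGen (m + 1)) ∈ bispan (m + 1) := by
  have hq := quatSum_toQuot m
  have ha3 := sGen_pow_three m
  have ha : sGen m ∈ strands (m + 1) := sGen_mem_strands m.lt_succ_self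
  rw [mul_inv_mul_eq (sGen_braid m) ha3]
  have h1 := one_mem (strands (m + 1))
  have h2 := pow_mem ha 2
  have hinv := sGen_inv (m + 1)
  have mem := fun g h hg hh => gen_mem_bispan (n := m + 1) (g := g) (h := h) hg hh
  have memi := fun g h hg hh => gen_inv_mem_bispan (n := m + 1) (g := g) (h := h) hg hh
  simp only [hinv] at memi
  have mem0 := mem_bispan ha
  generalize sGen m = a at *
  generalize sGen (m + 1) = b at *
  have key : toQuot idealK (a ^ 2 * (b ^ 2 * a * b ^ 2)) = -(toQuot idealK a +
      toQuot idealK (a ^ 2 * b ^ 2 * 1) + toQuot idealK (a * b * a ^ 2) +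
      toQuot idealK (1 * b * 1) + toQuot idealK (a * b ^ 2 * a) +
      toQuot idealK (a ^ 2 * b * a) + toQuot idealK (1 * b ^ 2 * a ^ 2)) := by
    have h3 : toQuot idealK a ^ 3 = 1 := by rw [← map_pow, ha3, map_one]
    simp only [map_mul, map_pow, one_mul, mul_one]
    generalize toQuot idealK a = x at *
    generalize toQuot idealK b = y at *
    -- The identity is `a * q = 0`: its last term is the element sought, and in each of the seven
    -- others `b` occurs at most once, as `b` or as `b²`.
    rw [eq_neg_iff_add_eq_zero, ← mul_zero x, ← hq, quatSum]
    have e1 : x * (x ^ 2 * y) = y := by rw [← mul_assoc, ← pow_succ', h3, one_mul]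
    have e2 : x * (x ^ 2 * y ^ 2 * x ^ 2) = y ^ 2 * x ^ 2 := by
      rw [mul_assoc, ← mul_assoc, ← pow_succ', h3, one_mul]
    simp only [mul_add, e1, e2]
    noncomm_ring
  rw [key]
  refine neg_mem ?_
  exact add_mem (add_mem (add_mem (add_mem (add_mem (add_mem mem0 (memi _ _ h2 h1))
    (mem _ _ ha h2)) (mem _ _ h1 h1)) (memi _ _ ha ha)) (mem _ _ h2 ha)) (memi _ _ h1 h2)

/-- As `bispan n` is already stable under `strands n` on both sides, this makes it stable under left
multiplication by all of `strands (n + 1)`. The form of `ih` makes it vacuous for `n = 0`. -/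
lemma gen_mul_mem_bispan {n : ℕ} (ih : ∀ g ∈ strands n, ∀ m, n = m + 1 →
      toQuot idealK g ∈ bispan m) {x : KInf} (hx : x ∈ bispan n) :
    toQuot idealK (sGen n) * x ∈ bispan n := by
  have h1 := one_mem (strands n)
  unfold bispan at hx
  induction hx using Submodule.span_induction with
  | zero => simp
  | add x y _ _ hx hy => rw [mul_add]; exact add_mem hx hy
  | smul c x _ hx => rw [mul_smul_comm]; exact Submodule.smul_mem _ c hx
  | mem x hx =>
    obtain ⟨x, hx | ⟨g, hg, h, hh, hx⟩, rfl⟩ := hx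
    · rw [← map_mul, ← one_mul (sGen n)]
      exact gen_mem_bispan h1 hx
    suffices H : ∀ t, t = sGen n ∨ t = (sGen n)⁻¹ →
        toQuot idealK (sGen n) * toQuot idealK g * toQuot idealK t ∈ bispan n by
      obtain ⟨t, ht, rfl⟩ : ∃ t, (t = sGen n ∨ t = (sGen n)⁻¹) ∧ x = g * t * h := by
        rcases hx with rfl | rfl
        exacts [⟨_, Or.inl rfl, rfl⟩, ⟨_, Or.inr rfl, rfl⟩]
      have := mul_mem_bispan h1 hh (H t ht)
      simpa only [map_mul, map_one, one_mul, mul_assoc] using this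
    intro t ht
    have hcomm : ∀ y ∈ strands n, sGen n * y = y * sGen n →
        toQuot idealK (sGen n) * toQuot idealK y * toQuot idealK t ∈ bispan n := by
      intro y hy hc
      rw [← map_mul, hc, ← map_mul, mul_assoc]
      rcases ht with rfl | rfl
      · have := sGen_inv n
        rw [← pow_two, ← this, ← mul_one (sGen n)⁻¹, ← mul_assoc]
        exact gen_inv_mem_bispan hy h1
      · rw [mul_inv_cancel, mul_one]
        exact mem_bispan hy
    cases n with
    | zero =>
      rw [strands_zero, Subgroup.mem_bot] at hg
      exact hcomm g (hg ▸ h1) (by rw [hg]; simp)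
    | succ m =>
      -- The middle factor is expanded by the spanning property one level below; everything in
      -- `strands m` commutes with `sGen (m + 1)`, which leaves words `b a^{±1} b^{±1}`.
      have hg' := ih g hg m rfl
      generalize toQuot idealK g = y at hg'
      unfold bispan at hg'
      induction hg' using Submodule.span_induction with
      | zero => simp
      | add x y _ _ hx hy => rw [mul_add, add_mul]; exact add_mem hx hy
      | smul c x _ hx => rw [mul_smul_comm, smul_mul_assoc]; exact Submodule.smul_mem _ c hx
      | mem y hy =>
        have hle : strands m ≤ strands (m + 1) := strands_mono m.le_succ
        obtain ⟨y, hy | ⟨g, hg, h, hh, hy⟩, rfl⟩ := hy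
        · exact hcomm y (hle hy) (commute_strands m.lt_succ_self hy)
        obtain ⟨r, hr, rfl⟩ : ∃ r, (r = sGen m ∨ r = (sGen m)⁻¹) ∧ y = g * r * h := by
          rcases hy with rfl | rfl
          exacts [⟨_, Or.inl rfl, rfl⟩, ⟨_, Or.inr rfl, rfl⟩]
        have htc : t * h = h * t := by
          have := commute_strands m.lt_succ_self hh
          rcases ht with rfl | rfl
          · exact this
          · exact (show Commute _ _ from this).inv_left
        rw [← map_mul, ← map_mul, show sGen (m + 1) * (g * r * h) * t =
          g * (sGen (m + 1) * r * t) * h by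
            rw [← mul_assoc, ← mul_assoc, commute_strands m.lt_succ_self hg, mul_assoc _ h t, ← htc]
            group, map_mul, map_mul]
        refine mul_mem_bispan (hle hg) (hle hh) ?_
        have hb := sGen_braid m
        have ha : sGen m ∈ strands (m + 1) := sGen_mem_strands m.lt_succ_self
        have hai := inv_mem ha
        -- Three of the four words are rewritten by the braid relation alone; `b a⁻¹ b` needs `q`.
        rcases hr with rfl | rfl <;> rcases ht with rfl | rfl
        · rw [← hb]
          exact gen_mem_bispan ha ha
        · rw [show sGen (m + 1) * sGen m * (sGen (m + 1))⁻¹ =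
            (sGen m)⁻¹ * sGen (m + 1) * sGen m by
              rw [mul_inv_eq_iff_eq_mul, mul_assoc, mul_assoc, eq_inv_mul_iff_mul_eq]
              simpa only [mul_assoc] using hb]
          exact gen_mem_bispan hai ha
        · exact gen_mul_inv_mul_gen_mem_bispan m
        · rw [show sGen (m + 1) * (sGen m)⁻¹ * (sGen (m + 1))⁻¹ =
            (sGen m)⁻¹ * (sGen (m + 1))⁻¹ * sGen m by
              rw [mul_inv_eq_iff_eq_mul, mul_assoc, mul_assoc, eq_inv_mul_iff_mul_eq,
                eq_inv_mul_iff_mul_eq, ← mul_assoc, ← mul_assoc, mul_inv_eq_iff_eq_mul]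
              simpa only [mul_assoc] using hb.symm]
          exact gen_inv_mem_bispan hai ha

lemma toQuot_mem_bispan (n : ℕ) : ∀ g ∈ strands (n + 1), toQuot idealK g ∈ bispan n := by
  induction n with
  | zero =>
    intro g hg
    induction hg using strands_induction with
    | one => exact mem_bispan (one_mem _)
    | mul i hi g _ ih =>
      obtain rfl : i = 0 := by omega
      rw [map_mul]
      exact gen_mul_mem_bispan (by intro _ _ m hm; omega) ih
  | succ n ihn =>
    intro g hg
    induction hg using strands_induction with
    | one => exact mem_bispan (one_mem _)
    | mul i hi g _ ih =>
      rw [map_mul]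
      obtain rfl | hi := eq_or_lt_of_le (Nat.le_of_lt_succ hi)
      · refine gen_mul_mem_bispan ?_ ih
        intro g hg m hm
        obtain rfl : m = n := by omega
        exact ihn g hg
      · simpa using mul_mem_bispan (sGen_mem_strands hi) (one_mem _) ih

/-! ### Markov traces on `K_∞` are determined by their value at `1` -/

/-- `MarkovPoly x P` is a certificate that `t x = P t 1` for every Markov trace `t`. -/
inductive MarkovPoly : KInf → PolyUV ℤ → Prop
  | one : MarkovPoly 1 1
  | add (x y P Q) : MarkovPoly x P → MarkovPoly y Q → MarkovPoly (x + y) (P + Q)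
  | smul (c : ℤ) (x P) : MarkovPoly x P → MarkovPoly (c • x) (c • P)
  | comm (x y P) : MarkovPoly (x * y) P → MarkovPoly (y * x) P
  | gen (n : ℕ) (g P) : g ∈ strands n → MarkovPoly (toQuot idealK g) P →
      MarkovPoly (toQuot idealK g * toQuot idealK (sGen n)) (X 0 * P)
  | gen_inv (n : ℕ) (g P) : g ∈ strands n → MarkovPoly (toQuot idealK g) P →
      MarkovPoly (toQuot idealK g * toQuot idealK (sGen n)⁻¹) (X 1 * P)

lemma MarkovPoly.apply_eq {M : Type*} [AddCommGroup M] [Module (PolyUV ℤ) M] {t : KInf →ₗ[ℤ] M}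
    (ht : IsMarkovTrace (toQuot idealK) t) {x : KInf} {P : PolyUV ℤ} (h : MarkovPoly x P) :
    t x = P • t 1 := by
  induction h with
  | one => rw [one_smul]
  | add x y P Q _ _ hx hy => rw [map_add, hx, hy, add_smul]
  | smul c x P _ hx => rw [map_smul, hx, smul_assoc]
  | comm x y P _ h => rw [ht.trace_mul_comm, h]
  | gen n g P hg _ h => rw [ht.trace_mul_gen n _ (Submodule.subset_span ⟨g, hg, rfl⟩), h, mul_smul]
  | gen_inv n g P hg _ h =>
    rw [ht.trace_mul_gen_inv n _ (Submodule.subset_span ⟨g, hg, rfl⟩), h, mul_smul]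

lemma exists_markovPoly_of_mem {n : ℕ} {g : GammaInf} (hg : g ∈ strands n) :
    ∃ P, MarkovPoly (toQuot idealK g) P := by
  induction n generalizing g with
  | zero =>
    rw [strands_zero, Subgroup.mem_bot] at hg
    exact ⟨1, by rw [hg, map_one]; exact .one⟩
  | succ n ih =>
    have := toQuot_mem_bispan n g hg
    unfold bispan at this
    generalize toQuot idealK g = x at this
    induction this using Submodule.span_induction with
    | zero => exact ⟨(0 : ℤ) • 1, by simpa using MarkovPoly.smul 0 _ _ .one⟩
    | add x y _ _ hx hy =>
      obtain ⟨P, hP⟩ := hx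
      obtain ⟨Q, hQ⟩ := hy
      exact ⟨_, .add _ _ _ _ hP hQ⟩
    | smul c x _ hx =>
      obtain ⟨P, hP⟩ := hx
      exact ⟨_, .smul c _ _ hP⟩
    | mem x hx =>
      obtain ⟨x, hx | ⟨g, hg, h, hh, rfl | rfl⟩, rfl⟩ := hx
      · exact ih hx
      -- Cyclicity brings `g s h` to `h g s`, with `h g` on fewer strands and the new generator
      -- last.
      all_goals
        obtain ⟨P, hP⟩ := ih (mul_mem hh hg)
        rw [map_mul]
      · refine ⟨X 0 * P, .comm _ _ _ ?_⟩
        rw [← map_mul, ← mul_assoc, map_mul]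
        exact .gen n _ _ (mul_mem hh hg) hP
      · refine ⟨X 1 * P, .comm _ _ _ ?_⟩
        rw [← map_mul, ← mul_assoc, map_mul]
        exact .gen_inv n _ _ (mul_mem hh hg) hP

lemma toQuot_induction {S : Type} [CommRing S] (I : TwoSidedIdeal (GroupAlg S))
    {p : QuotAlg I → Prop} (of : ∀ g, p (toQuot I g)) (add : ∀ x y, p x → p y → p (x + y))
    (smul : ∀ (c : S) x, p x → p (c • x)) (x : QuotAlg I) : p x := by
  obtain ⟨x, rfl⟩ := Ideal.Quotient.mk_surjective x
  induction x using MonoidAlgebra.induction_on with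
  | of g => exact of g
  | add x y hx hy => rw [map_add]; exact add _ _ hx hy
  | smul c x hx => exact smul c _ hx

lemma exists_markovPoly (x : KInf) : ∃ P, MarkovPoly x P := by
  induction x using toQuot_induction with
  | of g =>
    obtain ⟨n, hn⟩ := exists_mem_strands g
    exact exists_markovPoly_of_mem hn
  | add x y hx hy =>
    obtain ⟨P, hP⟩ := hx
    obtain ⟨Q, hQ⟩ := hy
    exact ⟨_, .add _ _ _ _ hP hQ⟩
  | smul c x hx =>
    obtain ⟨P, hP⟩ := hx
    exact ⟨_, .smul c _ _ hP⟩

end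

noncomputable section

/-! ### The cubic relation -/

section Cubic

variable {M : Type*} [AddCommGroup M] [Module (PolyUV ℤ) M] {t : KInf →ₗ[ℤ] M}

namespace IsMarkovTrace

lemma toQuot_mul_comm (ht : IsMarkovTrace (toQuot idealK) t) (g h : GammaInf) :
    t (toQuot idealK (g * h)) = t (toQuot idealK (h * g)) := by
  rw [map_mul, ht.trace_mul_comm, ← map_mul]

lemma toQuot_conj (ht : IsMarkovTrace (toQuot idealK) t) (g h : GammaInf) :
    t (toQuot idealK (g * h * g⁻¹)) = t (toQuot idealK h) := by
  rw [ht.toQuot_mul_comm, inv_mul_cancel_left]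

lemma toQuot_mul_gen (ht : IsMarkovTrace (toQuot idealK) t) {n : ℕ} {g : GammaInf}
    (hg : g ∈ strands n) :
    t (toQuot idealK (g * sGen n)) = (X 0 : PolyUV ℤ) • t (toQuot idealK g) := by
  rw [map_mul]
  exact ht.trace_mul_gen n _ (Submodule.subset_span ⟨g, hg, rfl⟩)

lemma toQuot_mul_gen_inv (ht : IsMarkovTrace (toQuot idealK) t) {n : ℕ} {g : GammaInf}
    (hg : g ∈ strands n) :
    t (toQuot idealK (g * (sGen n)⁻¹)) = (X 1 : PolyUV ℤ) • t (toQuot idealK g) := by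
  rw [map_mul]
  exact ht.trace_mul_gen_inv n _ (Submodule.subset_span ⟨g, hg, rfl⟩)

/-- The relation `q` multiplied by a group element, with the exponents `2` written as inverses. -/
lemma _root_.quatSum_relation {M : Type*} [AddCommGroup M] (t : KInf →ₗ[ℤ] M) (g : GammaInf) :
    t (toQuot idealK g) + t (toQuot idealK (sGen 0 * (sGen 1)⁻¹ * g)) +
      t (toQuot idealK (sGen 1 * (sGen 0)⁻¹ * g)) + t (toQuot idealK ((sGen 0)⁻¹ * sGen 1 * g)) +
      t (toQuot idealK ((sGen 1)⁻¹ * sGen 0 * g)) +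
      t (toQuot idealK (sGen 0 * sGen 1 * sGen 0 * g)) +
      t (toQuot idealK ((sGen 0)⁻¹ * (sGen 1)⁻¹ * (sGen 0)⁻¹ * g)) +
      t (toQuot idealK ((sGen 0 * (sGen 1)⁻¹) ^ 2 * g)) = 0 := by
  have h := congrArg t (congrArg (· * toQuot idealK g) (quatSum_toQuot 0))
  simp only [quatSum, ← map_pow, ← sGen_inv, ← map_mul, zero_add, add_mul, one_mul, map_add,
    zero_mul, map_zero] at h
  rw [pow_two, ← mul_assoc]
  exact h

/-- A Markov trace on `K_∞` whose value at `1` is killed by `4` is killed by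
`u ^ 3 + u v + v ^ 3 + 1`. -/
theorem cubicPoly_smul (ht : IsMarkovTrace (toQuot idealK) t) (h4 : (4 : ℤ) • t 1 = 0) :
    cubicPoly ℤ • t 1 = 0 := by
  have q1 := quatSum_relation t 1
  -- The multiplier is the square of an element of order 4 of the quaternion group on the next pair
  -- of generators. It is conjugate to the last term of `q` and commutes with `sGen 1`.
  have qz := quatSum_relation t ((sGen 1 * (sGen 2)⁻¹) ^ 2)
  have hab : sGen 0 * sGen 1 * sGen 0 = sGen 1 * sGen 0 * sGen 1 := sGen_braid 0
  have hbc : sGen 1 * sGen 2 * sGen 1 = sGen 2 * sGen 1 * sGen 2 := sGen_braid 1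
  have hac : sGen 0 * sGen 2 = sGen 2 * sGen 0 := sGen_comm (by omega)
  have hzz : t (toQuot idealK ((sGen 1 * (sGen 2)⁻¹) ^ 2)) =
      t (toQuot idealK ((sGen 0 * (sGen 1)⁻¹) ^ 2)) := by
    obtain ⟨g, ha, hb⟩ := exists_conj_pair 1
    rw [show sGen 2 = g * sGen 1 * g⁻¹ from hb.symm]
    nth_rw 1 [← ha]
    rw [conj_inv, conj_mul, conj_pow, ht.toQuot_conj]
  have ha' := sGen_inv 0
  have hb' := sGen_inv 1
  have hc' := sGen_inv 2
  have hb3 := sGen_pow_three 1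
  have hc3 := sGen_pow_three 2
  have ma : sGen 0 ∈ strands 1 := sGen_mem_strands (by omega)
  have mb : sGen 1 ∈ strands 2 := sGen_mem_strands (by omega)
  have ma2 : sGen 0 ∈ strands 2 := sGen_mem_strands (by omega)
  have Ta : t (toQuot idealK (sGen 0)) = (X 0 : PolyUV ℤ) • t 1 := by
    simpa using ht.toQuot_mul_gen (n := 0) (one_mem _)
  have Tai : t (toQuot idealK (sGen 0)⁻¹) = (X 1 : PolyUV ℤ) • t 1 := by
    simpa using ht.toQuot_mul_gen_inv (n := 0) (one_mem _)
  have Tab := ht.toQuot_mul_gen ma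
  have Tabi := ht.toQuot_mul_gen_inv ma
  have Taib := ht.toQuot_mul_gen (inv_mem ma)
  have Taibi := ht.toQuot_mul_gen_inv (inv_mem ma)
  have Tbac := ht.toQuot_mul_gen (mul_mem mb ma2)
  have Tbaici := ht.toQuot_mul_gen_inv (mul_mem (inv_mem mb) (inv_mem ma2))
  have Taci := ht.toQuot_mul_gen_inv ma2
  rw [Ta] at Tab Tabi Taci
  rw [Tai] at Taib Taibi
  have hZ := braid_mul_inv_sq hbc hc3
  have hZ' := braid_mul_inv_sq_symm hbc hb3
  have hZb : (sGen 1 * (sGen 2)⁻¹) ^ 2 * sGen 1 = sGen 1 * (sGen 1 * (sGen 2)⁻¹) ^ 2 := by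
    rw [hZ, hbc]; exact commute_braid_sq hbc.symm
  generalize sGen 0 = a at *
  generalize sGen 1 = b at *
  generalize sGen 2 = c at *
  have hac1 : c⁻¹ * a = a * c⁻¹ := by
    rw [inv_mul_eq_iff_eq_mul, ← mul_assoc, ← hac, mul_inv_cancel_right]
  have hb'' : b⁻¹ * b⁻¹ = b := by
    rw [← mul_inv_rev, inv_eq_iff_mul_eq_one, ← pow_two, ← pow_succ, hb3]
  have hc'' : c⁻¹ * c⁻¹ = c := by
    rw [← mul_inv_rev, inv_eq_iff_mul_eq_one, ← pow_two, ← pow_succ, hc3]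
  -- conjugation by `b` permutes cyclically the elements of order 4
  have c1 : a * b * a = b * (a * b⁻¹) * b⁻¹ := by
    rw [mul_assoc b, mul_assoc a b⁻¹, hb'', ← mul_assoc, hab]
  have c2 : b⁻¹ * a = b⁻¹ * (a * b⁻¹) * b⁻¹⁻¹ := by group
  have c3 : a⁻¹ * b⁻¹ * a⁻¹ = b * (b * a⁻¹) * b⁻¹ := by
    have : a⁻¹ * b⁻¹ * a⁻¹ = b⁻¹ * a⁻¹ * b⁻¹ := by
      simpa only [mul_inv_rev, mul_assoc] using congrArg (·⁻¹) hab
    rw [this, ← mul_assoc b b, ← pow_two, ← hb']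
  have c4 : a⁻¹ * b = b⁻¹ * (b * a⁻¹) * b⁻¹⁻¹ := by group
  simp only [mul_one, map_one] at q1
  rw [c1, c2, c3, c4] at q1 qz
  have conjZ : ∀ g x, g * (b * c⁻¹) ^ 2 = (b * c⁻¹) ^ 2 * g →
      t (toQuot idealK (g * x * g⁻¹ * (b * c⁻¹) ^ 2)) = t (toQuot idealK (x * (b * c⁻¹) ^ 2)) := by
    intro g x hg
    rw [← ht.toQuot_conj g (x * (b * c⁻¹) ^ 2)]
    congr 2
    have : g⁻¹ * (b * c⁻¹) ^ 2 = (b * c⁻¹) ^ 2 * g⁻¹ :=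
      ((show Commute _ _ from hg).inv_left)
    rw [mul_assoc, this]
    group
  have hZb' : b⁻¹ * (b * c⁻¹) ^ 2 = (b * c⁻¹) ^ 2 * b⁻¹ :=
    (show Commute _ _ from hZb.symm).inv_left
  rw [conjZ _ _ hZb.symm, conjZ _ _ hZb.symm, conjZ _ _ hZb', conjZ _ _ hZb'] at qz
  simp only [ht.toQuot_conj] at q1
  have Tbai : t (toQuot idealK (b * a⁻¹)) = (X 0 : PolyUV ℤ) • (X 1 : PolyUV ℤ) • t 1 := by
    rw [ht.toQuot_mul_comm, Taib]
  have Z1 : t (toQuot idealK (a * b⁻¹ * (b * c⁻¹) ^ 2)) =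
      (X 0 : PolyUV ℤ) • (X 0 : PolyUV ℤ) • (X 0 : PolyUV ℤ) • t 1 := by
    rw [show a * b⁻¹ * (b * c⁻¹) ^ 2 = a * c⁻¹ * b * c⁻¹ by rw [pow_two]; group,
      ht.toQuot_mul_comm,
      show c⁻¹ * (a * c⁻¹ * b) = (a * c) * b by
        rw [← mul_assoc, ← mul_assoc, hac1, mul_assoc a, hc''],
      ht.toQuot_mul_comm, ← mul_assoc, Tbac, ht.toQuot_mul_comm, Tab]
  have hac2 : c * a⁻¹ = a⁻¹ * c := (show Commute c a from hac.symm).inv_right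
  have Z2 : t (toQuot idealK (b * a⁻¹ * (b * c⁻¹) ^ 2)) =
      (X 1 : PolyUV ℤ) • (X 1 : PolyUV ℤ) • (X 1 : PolyUV ℤ) • t 1 := by
    rw [← hZ', mul_assoc, ht.toQuot_mul_comm,
      show a⁻¹ * (c * b⁻¹) ^ 2 * b = a⁻¹ * c * b⁻¹ * c by rw [pow_two]; group,
      ht.toQuot_mul_comm,
      show c * (a⁻¹ * c * b⁻¹) = (a⁻¹ * c⁻¹) * b⁻¹ by
        rw [← mul_assoc, ← mul_assoc, hac2, mul_assoc a⁻¹, ← pow_two, ← hc'],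
      ht.toQuot_mul_comm, ← mul_assoc, Tbaici, ht.toQuot_mul_comm, Taibi]
  have hbc1 : c⁻¹ * b⁻¹ * c⁻¹ = b⁻¹ * c⁻¹ * b⁻¹ := by
    simpa only [mul_inv_rev, mul_assoc] using congrArg (·⁻¹) hbc.symm
  have Z3 : t (toQuot idealK ((a * b⁻¹) ^ 2 * (b * c⁻¹) ^ 2)) =
      (X 1 : PolyUV ℤ) • (X 0 : PolyUV ℤ) • t 1 := by
    rw [show (a * b⁻¹) ^ 2 * (b * c⁻¹) ^ 2 = a * b⁻¹ * a * c⁻¹ * b * c⁻¹ by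
        rw [pow_two, pow_two]; group,
      ht.toQuot_mul_comm,
      show c⁻¹ * (a * b⁻¹ * a * c⁻¹ * b) = (a * b⁻¹) * (a * c⁻¹) * (a * b⁻¹)⁻¹ by
        calc c⁻¹ * (a * b⁻¹ * a * c⁻¹ * b) = (c⁻¹ * a) * b⁻¹ * (a * c⁻¹) * b := by group
          _ = (a * c⁻¹) * b⁻¹ * (c⁻¹ * a) * b := by rw [hac1]
          _ = a * (c⁻¹ * b⁻¹ * c⁻¹) * a * b := by group
          _ = a * b⁻¹ * c⁻¹ * b⁻¹ * (a * b * a) * a⁻¹ := by rw [hbc1]; group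
          _ = a * b⁻¹ * (c⁻¹ * a) * b * a⁻¹ := by rw [hab]; group
          _ = _ := by rw [hac1]; group,
      ht.toQuot_conj, Taci]
  have h4' : (4 : PolyUV ℤ) • t 1 = 0 := by
    rw [← h4, ← Int.cast_smul_eq_zsmul (PolyUV ℤ)]
    norm_num
  rw [hzz, Z1, Z2, Z3] at qz
  rw [Tabi, Tbai] at q1
  unfold cubicPoly
  -- With `z` this multiplier, `q1` reads `(1 + 6uv) t(1) + t(z) = 0` and `qz` reads `t(z) + (3u³ +
  -- 3v³ + uv) t(1) = 0`. The difference `1 + 5uv - 3u³ - 3v³` is the cubic modulo 4.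
  linear_combination (norm := module) q1 - qz + (X 0 ^ 3 + X 1 ^ 3 - X 0 * X 1 : PolyUV ℤ) • h4'

end IsMarkovTrace

end Cubic

end

noncomputable section

/-! ### The morphism from `K_∞` to the ternary Hecke algebra -/

/-- Under the quadratic and braid relations, `q` reduces to `-4 (a + b + a b + b a)`; this is where
4 comes from. -/
lemma quatSum_eq_zero {H : Type*} [Ring H] {a b : H} (ha : a * a = -a - 1) (hb : b * b = -b - 1)
    (hab : a * b * a = b * a * b) (h4 : (4 : H) = 0) : quatSum a b = 0 := by
  have e1 : a ^ 2 * b ^ 2 * a ^ 2 = -(a + b + a * b + b * a + a * b * a) := by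
    calc a ^ 2 * b ^ 2 * a ^ 2 = (a * a) * (b * b) * (a * a) := by noncomm_ring
      _ = (-a - 1) * (-b - 1) * (-a - 1) := by rw [ha, hb]
      _ = -(1 + 2 * a + b + a * b + b * a + a * b * a + a * a) := by noncomm_ring
      _ = _ := by rw [ha]; noncomm_ring
  have e2 : a * b ^ 2 * a * b ^ 2 = -1 - a - b - a * b - b * a := by
    calc a * b ^ 2 * a * b ^ 2 = a * (b * b) * a * (b * b) := by noncomm_ring
      _ = a * a * (1 + b) + a * b * a + a * (b * a * b) := by rw [hb]; noncomm_ring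
      _ = a * a * (1 + b + b * a) + a * b * a := by rw [← hab]; noncomm_ring
      _ = _ := by rw [ha]; noncomm_ring
  calc quatSum a b = 1 + a * (b * b) + b * (a * a) + a * a * b + b * b * a + a * b * a +
        a ^ 2 * b ^ 2 * a ^ 2 + a * b ^ 2 * a * b ^ 2 := by unfold quatSum; noncomm_ring
    _ = -(4 * (a + b + a * b + b * a)) := by rw [e1, e2, ha, hb]; noncomm_ring
    _ = 0 := by rw [h4, zero_mul, neg_zero]

/-- Every term of `q` has degree 0, 3 or 6. Rescaling by cube roots of unity thus reduces the three
Hecke algebras to the relation `s² + s + 1 = 0`. -/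
lemma quatSum_smul {S H : Type*} [CommRing S] [Ring H] [Algebra S H] {c : S} (hc : c ^ 3 = 1)
    (a b : H) : quatSum (c • a) (c • b) = quatSum a b := by
  have h1 : c * c * c = 1 := by rw [← hc]; ring
  have h2 : c ^ 2 * c ^ 2 * c ^ 2 = 1 := by linear_combination (c ^ 3 + 1) * hc
  have h3 : c * c ^ 2 = 1 := by rw [← hc]; ring
  have h4 : c ^ 2 * c = 1 := by rw [← hc]; ring
  simp only [quatSum, smul_pow, smul_mul_smul_comm, h1, h2, h3, h4, one_smul]
  simp only [smul_mul_assoc, mul_smul_comm, smul_smul, h4, one_smul]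

lemma map_quatSum {H H' F : Type*} [Ring H] [Ring H'] [FunLike F H H'] [RingHomClass F H H']
    (f : F) (a b : H) : f (quatSum a b) = quatSum (f a) (f b) := by
  simp only [quatSum, map_add, map_mul, map_pow, map_one]

lemma jR_pow_three : jR ^ 3 = 1 := by linear_combination (jR - 1) * jR_rel

/-- The element `γ = j ^ k`. -/
abbrev gam (k : Fin 3) : R4 := jR ^ (k : ℕ)

lemma gam_pow_three (k : Fin 3) : gam k ^ 3 = 1 := by
  rw [← pow_mul, mul_comm, pow_mul, jR_pow_three, one_pow]

lemma hecke_quad (k : Fin 3) :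
    toQuot (idealHγ k) (sGen 0) * toQuot (idealHγ k) (sGen 0) =
      -(gam k • toQuot (idealHγ k) (sGen 0)) - (gam k ^ 2) • 1 := by
  have h : Ideal.Quotient.mk (idealHγ k).asIdeal
      ((gr R4 (sGen 0) - algebraMap R4 _ (jR ^ ((k : ℕ) + 1))) *
        (gr R4 (sGen 0) - algebraMap R4 _ (jR ^ ((k : ℕ) + 2)))) = 0 :=
    Ideal.Quotient.eq_zero_iff_mem.2 (TwoSidedIdeal.subset_span rfl)
  have e : (gr R4 (sGen 0) - algebraMap R4 _ (jR ^ ((k : ℕ) + 1))) *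
        (gr R4 (sGen 0) - algebraMap R4 _ (jR ^ ((k : ℕ) + 2))) =
      gr R4 (sGen 0) * gr R4 (sGen 0) + gam k • gr R4 (sGen 0) + (gam k ^ 2) • 1 := by
    have h1 : jR ^ ((k : ℕ) + 1) + jR ^ ((k : ℕ) + 2) = -gam k := by
      linear_combination jR ^ (k : ℕ) * jR_rel
    have h2 : jR ^ ((k : ℕ) + 1) * jR ^ ((k : ℕ) + 2) = gam k ^ 2 := by
      linear_combination (jR ^ (k : ℕ)) ^ 2 * jR_pow_three
    rw [sub_mul, mul_sub, mul_sub, ← Algebra.commutes,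
      ← map_mul (algebraMap R4 (GroupAlg R4)), h2, ← Algebra.smul_def,
      ← Algebra.smul_def, Algebra.algebraMap_eq_smul_one, ← neg_eq_iff_eq_neg.2 h1, neg_smul,
      add_smul]
    abel
  rw [e] at h
  have h' : toQuot (idealHγ k) (sGen 0) * toQuot (idealHγ k) (sGen 0) +
      gam k • toQuot (idealHγ k) (sGen 0) + (gam k ^ 2) • 1 = 0 := h
  rw [← sub_eq_zero, ← h']
  abel

lemma four_eq_zero_of_algebra {H : Type*} [Ring H] [Algebra R4 H] : (4 : H) = 0 := by
  rw [← map_ofNat (algebraMap R4 H) 4, four_R4, map_zero]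

lemma quatSum_hecke (k : Fin 3) :
    quatSum (toQuot (idealHγ k) (sGen 0)) (toQuot (idealHγ k) (sGen 1)) = 0 := by
  have h3 := gam_pow_three k
  have h23 : (gam k ^ 2) ^ 3 = 1 := by rw [pow_right_comm, h3, one_pow]
  have hq0 := hecke_quad k
  obtain ⟨g, ha, -⟩ := exists_conj_pair 1
  have hab : toQuot (idealHγ k) (sGen 0) * toQuot (idealHγ k) (sGen 1) *
      toQuot (idealHγ k) (sGen 0) = toQuot (idealHγ k) (sGen 1) * toQuot (idealHγ k) (sGen 0) *
      toQuot (idealHγ k) (sGen 1) := by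
    simp only [← map_mul]; exact congrArg _ (sGen_braid 0)
  have hq1 : toQuot (idealHγ k) (sGen 1) * toQuot (idealHγ k) (sGen 1) =
      -(gam k • toQuot (idealHγ k) (sGen 1)) - (gam k ^ 2) • 1 := by
    have hg : toQuot (idealHγ k) g * toQuot (idealHγ k) g⁻¹ = 1 := by
      rw [← map_mul, mul_inv_cancel, map_one]
    have hs : toQuot (idealHγ k) (sGen 1) = toQuot (idealHγ k) g * toQuot (idealHγ k) (sGen 0) *
      toQuot (idealHγ k) g⁻¹ := by rw [← map_mul, ← map_mul, ha]
    calc toQuot (idealHγ k) (sGen 1) * toQuot (idealHγ k) (sGen 1)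
        = toQuot (idealHγ k) g * (toQuot (idealHγ k) (sGen 0) * toQuot (idealHγ k) (sGen 0)) *
          toQuot (idealHγ k) g⁻¹ := by
          simp only [← map_mul, ← ha]
          congr 1
          group
      _ = _ := by
          rw [hq0, mul_sub, sub_mul, mul_neg, neg_mul, mul_smul_comm, mul_smul_comm,
            smul_mul_assoc, smul_mul_assoc, mul_one, hg, ← hs]
  rw [← quatSum_smul h23]
  generalize toQuot (idealHγ k) (sGen 0) = a at *
  generalize toQuot (idealHγ k) (sGen 1) = b at *
  have key : ∀ x : HeckeInf k, x * x = -(gam k • x) - (gam k ^ 2) • 1 →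
      (gam k ^ 2 • x) * (gam k ^ 2 • x) = -(gam k ^ 2 • x) - 1 := by
    intro x hx
    have e1 : gam k ^ 2 * gam k ^ 2 * gam k = gam k ^ 2 := by linear_combination gam k ^ 2 * h3
    have e2 : gam k ^ 2 * gam k ^ 2 * gam k ^ 2 = 1 := by linear_combination h23
    rw [smul_mul_smul_comm, hx, smul_sub, smul_neg, smul_smul, smul_smul, e1, e2, one_smul]
  refine quatSum_eq_zero (key a hq0) (key b hq1) ?_ four_eq_zero_of_algebra
  simp only [smul_mul_smul_comm, hab]

lemma eq_zero_of_mem_span {A B : Type*} [Ring A] [Ring B] (f : A →+* B) {x : A} (hx : f x = 0)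
    {y : A} (hy : y ∈ (TwoSidedIdeal.span {x}).asIdeal) : f y = 0 := by
  have : TwoSidedIdeal.span {x} ≤ TwoSidedIdeal.ker f :=
    TwoSidedIdeal.span_le.2 (by
      rintro _ rfl
      exact (TwoSidedIdeal.mem_ker f).2 hx)
  exact (TwoSidedIdeal.mem_ker f).1 (this hy)

lemma quatSum_ternary :
    quatSum (toQuot idealTernary (sGen 0)) (toQuot idealTernary (sGen 1)) = 0 := by
  have : ∀ I : TwoSidedIdeal (GroupAlg R4), quatSum (toQuot I (sGen 0)) (toQuot I (sGen 1)) =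
      Ideal.Quotient.mk I.asIdeal (quatSum (gr R4 (sGen 0)) (gr R4 (sGen 1))) := fun I =>
    (map_quatSum (Ideal.Quotient.mk I.asIdeal) _ _).symm
  rw [this, Ideal.Quotient.eq_zero_iff_mem]
  refine (TwoSidedIdeal.mem_iInf _).2 fun k => ?_
  have h := quatSum_hecke k
  rwa [this, Ideal.Quotient.eq_zero_iff_mem] at h

/-- The morphism from `K_∞` to the ternary Hecke algebra. -/
def piMap : KInf →+* TernaryInf :=
  Ideal.Quotient.lift idealK.asIdeal
    (MonoidAlgebra.lift ℤ TernaryInf GammaInf (toQuot idealTernary) : GroupAlg ℤ →+* TernaryInf)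
    fun y hy => eq_zero_of_mem_span _ (by
      have h : qElt = quatSum (gr ℤ (sGen 0)) (gr ℤ (sGen 1)) := rfl
      rw [h, map_quatSum]
      simpa using quatSum_ternary) hy

lemma piMap_toQuot (g : GammaInf) : piMap (toQuot idealK g) = toQuot idealTernary g := by
  change (MonoidAlgebra.lift ℤ TernaryInf GammaInf (toQuot idealTernary)) (MonoidAlgebra.of ℤ _ g) = _
  simp

/-! ### The Markov traces of the Hecke algebras -/

lemma isMarkovTrace_of_generators {S : Type} [CommRing S] {H : Type} [Ring H] [Algebra S H]
    {M : Type*} [AddCommGroup M] [Module S M] [Module (PolyUV S) M] [IsScalarTower S (PolyUV S) M]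
    {ρ : GammaInf →* H} {t : H →ₗ[S] M} (hc : ∀ x y : H, t (x * y) = t (y * x))
    (hg : ∀ n, ∀ g ∈ strands n, t (ρ g * ρ (sGen n)) = (X 0 : PolyUV S) • t (ρ g))
    (hi : ∀ n, ∀ g ∈ strands n, t (ρ g * ρ (sGen n)⁻¹) = (X 1 : PolyUV S) • t (ρ g)) :
    IsMarkovTrace ρ t := by
  have key : ∀ (y : H) (P : PolyUV S) n, (∀ g ∈ strands n, t (ρ g * y) = P • t (ρ g)) →
      ∀ x ∈ Submodule.span S (ρ '' (strands n : Set GammaInf)), t (x * y) = P • t x := by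
    intro y P n h x hx
    induction hx using Submodule.span_induction with
    | mem x hx =>
      obtain ⟨g, hg, rfl⟩ := hx
      exact h g hg
    | zero => simp
    | add x z _ _ hx hz => rw [add_mul, map_add, map_add, smul_add, hx, hz]
    | smul c x _ hx =>
      rw [smul_mul_assoc, map_smul, map_smul, hx, ← smul_assoc, ← algebraMap_smul (PolyUV S) c (t x),
        smul_smul, Algebra.smul_def, mul_comm]
  exact ⟨hc, fun n => key _ _ n (hg n), fun n => key _ _ n (hi n)⟩

/-- The Ocneanu trace, with the generators multiplied by `γ = j ^ k`. -/
theorem exists_twisted_trace {A : Type} [CommRing A] [Algebra R4 A] (k : Fin 3) (u v : A)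
    (huv : v + algebraMap R4 A (gam k) * u + algebraMap R4 A (gam k) ^ 2 = 0) :
    ∃ t : HeckeInf k →ₗ[R4] A, t 1 = 1 ∧ (∀ x y, t (x * y) = t (y * x)) ∧
      ∀ n, ∀ g ∈ strands n,
        t (toQuot (idealHγ k) g * toQuot (idealHγ k) (sGen n)) = u * t (toQuot (idealHγ k) g) ∧
        t (toQuot (idealHγ k) g * toQuot (idealHγ k) (sGen n)⁻¹) = v * t (toQuot (idealHγ k) g) := by
  let _ : Algebra R4 (HeckeAlg A) :=
    ((algebraMap A (HeckeAlg A)).comp (algebraMap R4 A)).toAlgebra' fun c x => by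
      simp [Algebra.commutes]
  have : IsScalarTower R4 A (HeckeAlg A) := IsScalarTower.of_algebraMap_eq fun _ => rfl
  obtain ⟨γ, hγdef⟩ : ∃ γ, γ = algebraMap R4 A (gam k) := ⟨_, rfl⟩
  rw [← hγdef] at huv
  have hγ : γ ^ 3 = 1 := by rw [hγdef, ← map_pow, gam_pow_three k, map_one]
  have hω : algebraMap R4 A jR * algebraMap R4 A jR = -algebraMap R4 A jR - 1 := by
    rw [← map_mul, ← map_one (algebraMap R4 A), ← map_neg, ← map_sub]
    congr 1
    linear_combination jR_rel
  -- The generators go to `γ • gen i`, so the parameter `γ² u` produces `γ³ u = u`.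
  obtain ⟨τ, τ1, τc, τg⟩ := HeckeAlg.exists_trace (γ ^ 2 * u) (algebraMap R4 A jR) hω
  have rel := HeckeAlg.relations A
  have hs3 : ∀ i, (γ • HeckeAlg.gen A i) ^ 3 = 1 := fun i => by
    rw [smul_pow, hγ, rel.pow_three, one_smul]
  let f : ℕ → (HeckeAlg A)ˣ := fun i => Units.ofPowEqOne _ 3 (hs3 i) (by norm_num)
  have hf : ∀ i, (f i : HeckeAlg A) = γ • HeckeAlg.gen A i := fun i => rfl
  let θ : GammaInf →* HeckeAlg A := (Units.coeHom _).comp (gammaLift f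
    (fun i j h => Units.ext (by
      simp only [Units.val_mul, hf, smul_mul_smul_comm, rel.comm i j h]))
    (fun i => Units.ext (by
      simp only [Units.val_mul, hf, smul_mul_smul_comm, rel.braid i]))
    (Units.ext (by rw [Units.val_pow_eq_pow_val, hf, hs3]; rfl)))
  have hθ : ∀ i, θ (sGen i) = γ • HeckeAlg.gen A i := fun i => by
    simp [θ, hf]
  have hθi : ∀ i, θ (sGen i)⁻¹ = γ ^ 2 • (-HeckeAlg.gen A i - 1) := fun i => by
    rw [sGen_inv, map_pow, hθ, smul_pow, pow_two (HeckeAlg.gen A i), rel.quad]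
  have hθsub : ∀ n, ∀ g ∈ strands n, θ g ∈ HeckeAlg.sub A n := fun n g hg => by
    induction hg using strands_induction with
    | one => rw [map_one]; exact one_mem _
    | mul i hi g _ ih =>
      rw [map_mul, hθ]
      exact mul_mem (Subalgebra.smul_mem _ (HeckeAlg.gen_mem_sub hi) _) ih
  let Θ : GroupAlg R4 →ₐ[R4] HeckeAlg A := MonoidAlgebra.lift R4 (HeckeAlg A) GammaInf θ
  have hΘ : ∀ g, Θ (gr R4 g) = θ g := fun g => by simp [Θ]
  have hker : ∀ y ∈ (idealHγ k).asIdeal, Θ y = 0 := fun y hy =>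
    eq_zero_of_mem_span (Θ : GroupAlg R4 →+* HeckeAlg A) (by
      have hsm : ∀ c : R4, algebraMap R4 (HeckeAlg A) c = algebraMap R4 A c • 1 := fun c => by
        rw [← Algebra.algebraMap_eq_smul_one]; rfl
      have e1 : algebraMap R4 A (jR ^ ((k : ℕ) + 1)) + algebraMap R4 A (jR ^ ((k : ℕ) + 2)) =
          -γ := by
        rw [hγdef, ← map_add, ← map_neg]
        congr 1
        linear_combination jR ^ (k : ℕ) * jR_rel
      have e2 : algebraMap R4 A (jR ^ ((k : ℕ) + 1)) * algebraMap R4 A (jR ^ ((k : ℕ) + 2)) =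
          γ ^ 2 := by
        rw [hγdef, ← map_mul, ← map_pow]
        congr 1
        linear_combination (jR ^ (k : ℕ)) ^ 2 * jR_pow_three
      rw [AlgHom.coe_toRingHom, map_mul, map_sub, map_sub, hΘ, AlgHom.commutes, AlgHom.commutes,
        hθ, hsm, hsm]
      generalize algebraMap R4 A (jR ^ ((k : ℕ) + 1)) = α at *
      generalize algebraMap R4 A (jR ^ ((k : ℕ) + 2)) = β at *
      rw [sub_mul, mul_sub, mul_sub, smul_mul_smul_comm, smul_mul_smul_comm, smul_mul_smul_comm,
        smul_mul_smul_comm, rel.quad, mul_one, one_mul, mul_one, e2]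
      have : β = -γ - α := by linear_combination e1
      rw [this]
      module) hy
  let Ψ : HeckeInf k →ₐ[R4] HeckeAlg A := Ideal.Quotient.liftₐ _ Θ hker
  have hΨ : ∀ g, Ψ (toQuot (idealHγ k) g) = θ g := hΘ
  have hval : ∀ x, ((τ.restrictScalars R4) ∘ₗ Ψ.toLinearMap) x = τ (Ψ x) := fun _ => rfl
  refine ⟨(τ.restrictScalars R4) ∘ₗ Ψ.toLinearMap, ?_, fun x y => ?_, fun n g hg => ⟨?_, ?_⟩⟩
  · rw [hval, map_one, τ1]
  · rw [hval, hval, map_mul Ψ, map_mul Ψ, τc]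
  · rw [hval, hval, map_mul Ψ, hΨ, hΨ, hθ, mul_smul_comm, map_smul, τg n _ (hθsub n g hg),
      smul_eq_mul]
    linear_combination (u * τ (θ g)) * hγ
  -- The inverse generator contributes `γ² (-γ² u - 1) = -γ u - γ²`, which is `v` by `huv`.
  · rw [hval, hval, map_mul Ψ, hΨ, hΨ, hθi, mul_smul_comm, map_smul, mul_sub, mul_neg, mul_one,
      map_sub, map_neg, τg n _ (hθsub n g hg), smul_eq_mul]
    linear_combination (-γ * u * τ (θ g)) * hγ - τ (θ g) * huv

theorem exists_heckeTrace (k : Fin 3) : ∃ t : HeckeInf k →ₗ[R4] LinRing k,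
    IsMarkovTrace (toQuot (idealHγ k)) t ∧ t 1 = 1 := by
  have h : Ideal.Quotient.mk (Ideal.span {linPoly k}) (linPoly k) = 0 :=
    Ideal.Quotient.eq_zero_iff_mem.2 (Ideal.mem_span_singleton_self _)
  obtain ⟨t, t1, tc, tg⟩ := exists_twisted_trace k (A := LinRing k)
    (Ideal.Quotient.mk _ (X 0)) (Ideal.Quotient.mk _ (X 1)) (by
      rw [linPoly, map_add, map_add, map_mul] at h
      rw [← map_pow]
      exact h)
  exact ⟨t, isMarkovTrace_of_generators tc (fun n g hg => (tg n g hg).1)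
    (fun n g hg => (tg n g hg).2), t1⟩

end

noncomputable section

/-! ### Divisibility by the cubic polynomial -/

/-- The evaluation `v = -γ u - γ ^ 2`. -/
def evalLin (k : Fin 3) : PolyUV R4 →ₐ[R4] Polynomial R4 :=
  aeval ![Polynomial.X, -(Polynomial.C (gam k) * Polynomial.X) - Polynomial.C (gam k ^ 2)]

/-- The form is monic in `v`, so the quotient by it is a polynomial ring in `u`, reached by solving
for `v`. -/
lemma linPoly_dvd_iff (k : Fin 3) (P : PolyUV R4) : linPoly k ∣ P ↔ evalLin k P = 0 := by
  constructor
  · rintro ⟨Q, rfl⟩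
    have : evalLin k (linPoly k) = 0 := by
      simp [evalLin, linPoly, Polynomial.algebraMap_eq]
      ring
    rw [map_mul, this, zero_mul]
  · intro h
    let q : PolyUV R4 →ₐ[R4] LinRing k := Ideal.Quotient.mkₐ R4 _
    have hq : q (X 1 + C (gam k) * X 0 + C (gam k ^ 2)) = 0 :=
      Ideal.Quotient.eq_zero_iff_mem.2 (Ideal.mem_span_singleton_self _)
    have hcomp : (Polynomial.aeval (q (X 0))).comp (evalLin k) = q := by
      refine MvPolynomial.algHom_ext fun i => ?_
      fin_cases i
      · simp [evalLin]
      · have h2 : q (X 1) = -(algebraMap R4 (LinRing k) (gam k) * q (X 0)) -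
            algebraMap R4 (LinRing k) (gam k ^ 2) := by
          have e : ∀ c, q (C c) = algebraMap R4 (LinRing k) c := fun c => q.commutes c
          rw [map_add, map_add, map_mul, e, e] at hq
          linear_combination hq
        simpa [evalLin] using h2.symm
    rw [← Ideal.mem_span_singleton, ← Ideal.Quotient.eq_zero_iff_mem]
    change q P = 0
    rw [← hcomp, AlgHom.comp_apply, h, map_zero]

lemma isUnit_gam_sub {k l : Fin 3} (h : k ≠ l) : IsUnit (gam l - gam k) := by
  have h3 := jR_rel
  have h4 := four_R4
  have key : ∀ x y : R4, x ^ 3 = 1 → y ^ 3 = 1 → x ^ 2 + x * y + y ^ 2 = 0 → IsUnit (x - y) := by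
    intro x y hx hy hxy
    -- Since `-3 = 1`, `(x - y)² = (x² + x y + y²) - 3 x y = x y`, a cube root of unity.
    refine IsUnit.of_mul_eq_one ((x - y) * (x * y) ^ 2) ?_
    linear_combination (x * y) ^ 2 * hxy + y ^ 3 * hx + hy - x ^ 3 * y ^ 3 * h4 +
      4 * y ^ 3 * hx + 4 * hy - 4 * x ^ 3 * hy - 4 * hx
  refine key _ _ (gam_pow_three l) (gam_pow_three k) ?_
  fin_cases k <;> fin_cases l <;> try exact absurd rfl h
  · change (jR ^ 1) ^ 2 + jR ^ 1 * jR ^ 0 + (jR ^ 0) ^ 2 = 0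
    linear_combination 1 * h3
  · change (jR ^ 2) ^ 2 + jR ^ 2 * jR ^ 0 + (jR ^ 0) ^ 2 = 0
    linear_combination (jR ^ 2 - jR + 1) * h3
  · change (jR ^ 0) ^ 2 + jR ^ 0 * jR ^ 1 + (jR ^ 1) ^ 2 = 0
    linear_combination 1 * h3
  · change (jR ^ 2) ^ 2 + jR ^ 2 * jR ^ 1 + (jR ^ 1) ^ 2 = 0
    linear_combination jR ^ 2 * h3
  · change (jR ^ 0) ^ 2 + jR ^ 0 * jR ^ 2 + (jR ^ 2) ^ 2 = 0
    linear_combination (jR ^ 2 - jR + 1) * h3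
  · change (jR ^ 1) ^ 2 + jR ^ 1 * jR ^ 2 + (jR ^ 2) ^ 2 = 0
    linear_combination jR ^ 2 * h3

/-- `R4` is not a domain, so primality is unavailable. Restricted to the zero locus of `linPoly k`,
however, `linPoly l` is a unit times a monic polynomial in `u`, hence regular. -/
lemma linPoly_dvd_of_dvd_mul {k l : Fin 3} (h : k ≠ l) {Q : PolyUV R4}
    (hQ : linPoly k ∣ linPoly l * Q) : linPoly k ∣ Q := by
  rw [linPoly_dvd_iff] at hQ ⊢
  have e : evalLin k (linPoly l) =
      Polynomial.C (gam l - gam k) * (Polynomial.X + Polynomial.C (gam l + gam k)) := by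
    simp only [evalLin, linPoly, map_add, map_mul, aeval_X, aeval_C, Polynomial.algebraMap_eq,
      map_sub, map_pow]
    simp
    ring
  rw [map_mul, e, mul_assoc] at hQ
  have hu : IsUnit (Polynomial.C (gam l - gam k)) := (isUnit_gam_sub h).map _
  rw [hu.mul_right_eq_zero] at hQ
  exact (Polynomial.monic_X_add_C _).isRegular.left.mul_left_eq_zero_iff.1 hQ

lemma cubicPoly_dvd {P : PolyUV R4} (h : ∀ k, linPoly k ∣ P) : cubicPoly R4 ∣ P := by
  obtain ⟨Q, rfl⟩ := h 0
  obtain ⟨Q, rfl⟩ := linPoly_dvd_of_dvd_mul (k := 1) (l := 0) (by decide) (h 1)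
  obtain ⟨Q, rfl⟩ := linPoly_dvd_of_dvd_mul (k := 2) (l := 1) (by decide)
    (linPoly_dvd_of_dvd_mul (k := 2) (l := 0) (by decide) (h 2))
  exact ⟨Q, by rw [cubicPoly_eq_prod]; ring⟩

lemma redLin_injective {y z : CubicRing R4} (h : ∀ k, redLin k y = redLin k z) : y = z := by
  obtain ⟨P, rfl⟩ := Ideal.Quotient.mk_surjective y
  obtain ⟨Q, rfl⟩ := Ideal.Quotient.mk_surjective z
  rw [Ideal.Quotient.mk_eq_mk_iff_sub_mem, Ideal.mem_span_singleton]
  refine cubicPoly_dvd fun k => ?_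
  rw [← Ideal.mem_span_singleton, ← Ideal.Quotient.mk_eq_mk_iff_sub_mem]
  exact h k

/-! ### Descent from `(ℤ/4)[j]` to `ℤ/4` -/

/-- A polynomial of degree at most 1 divisible by the monic quadratic `X² + X + 1` is zero. -/
lemma R4_coord_eq_zero {a b : ZMod 4} (h : algebraMap (ZMod 4) R4 a + jR * algebraMap (ZMod 4) R4 b = 0) :
    a = 0 := by
  have hm : (Polynomial.X ^ 2 + Polynomial.X + 1 : Polynomial (ZMod 4)).Monic := by monicity!
  have hd : (Polynomial.X ^ 2 + Polynomial.X + 1 : Polynomial (ZMod 4)).degree = 2 := by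
    compute_degree!
  have h' : AdjoinRoot.mk (Polynomial.X ^ 2 + Polynomial.X + 1 : Polynomial (ZMod 4))
      (Polynomial.C a + Polynomial.X * Polynomial.C b) = 0 := by
    rw [map_add, map_mul, AdjoinRoot.mk_C, AdjoinRoot.mk_C, AdjoinRoot.mk_X]
    exact h
  rw [AdjoinRoot.mk_eq_zero, add_comm (Polynomial.C a), mul_comm Polynomial.X] at h'
  by_contra ha
  refine hm.not_dvd_of_degree_lt ?_ ?_ h'
  · intro h0
    exact ha (by simpa using congrArg (Polynomial.coeff · 0) h0)
  · rw [hd]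
    exact lt_of_le_of_lt Polynomial.degree_linear_le (by norm_num)

lemma R4_exists_coord (r : R4) :
    ∃ a b : ZMod 4, r = algebraMap (ZMod 4) R4 a + jR * algebraMap (ZMod 4) R4 b := by
  obtain ⟨p, rfl⟩ := AdjoinRoot.mk_surjective r
  induction p using Polynomial.induction_on with
  | C a => exact ⟨a, 0, by rw [map_zero, mul_zero, add_zero]; rfl⟩
  | add p q hp hq =>
    obtain ⟨a, b, hp⟩ := hp
    obtain ⟨c, d, hq⟩ := hq
    exact ⟨a + c, b + d, by rw [map_add, hp, hq, map_add, map_add]; ring⟩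
  | monomial n c h =>
    obtain ⟨a, b, h⟩ := h
    refine ⟨-b, a - b, ?_⟩
    rw [pow_succ Polynomial.X n, ← mul_assoc, map_mul, h, AdjoinRoot.mk_X, map_neg, map_sub]
    change _ * jR = _
    linear_combination algebraMap (ZMod 4) R4 b * jR_rel

/-- Extension of scalars from `ℤ/4` to `(ℤ/4)[j]`. -/
abbrev mapR4 : PolyUV (ZMod 4) →+* PolyUV R4 := MvPolynomial.map (algebraMap (ZMod 4) R4)

lemma exists_map_add (Q : PolyUV R4) : ∃ A B : PolyUV (ZMod 4), Q = mapR4 A + C jR * mapR4 B := by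
  induction Q using MvPolynomial.induction_on with
  | C r =>
    obtain ⟨a, b, rfl⟩ := R4_exists_coord r
    exact ⟨C a, C b, by simp⟩
  | add p q hp hq =>
    obtain ⟨a, b, rfl⟩ := hp
    obtain ⟨c, d, rfl⟩ := hq
    exact ⟨a + c, b + d, by rw [map_add, map_add]; ring⟩
  | mul_X p i hp =>
    obtain ⟨a, b, rfl⟩ := hp
    exact ⟨a * X i, b * X i, by simp only [map_mul, map_X]; ring⟩

lemma map_coord_eq_zero {A B : PolyUV (ZMod 4)} (h : mapR4 A + C jR * mapR4 B = 0) : A = 0 := by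
  ext m
  have := congrArg (coeff m) h
  rw [coeff_add, coeff_C_mul, coeff_map, coeff_map, coeff_zero] at this
  rw [R4_coord_eq_zero this, coeff_zero]

lemma map_cubicPoly {S T : Type} [CommRing S] [CommRing T] (f : S →+* T) :
    MvPolynomial.map f (cubicPoly S) = cubicPoly T := by
  simp [cubicPoly]

/-- The cubic has coefficients in `ℤ/4`, so multiplication by it respects the components along `1`
and `j`; the component of the quotient along `1` is the cofactor. -/
lemma cubicPoly_dvd_of_map {P : PolyUV (ZMod 4)} (h : cubicPoly R4 ∣ mapR4 P) :
    cubicPoly (ZMod 4) ∣ P := by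
  obtain ⟨Q, hQ⟩ := h
  obtain ⟨A, B, rfl⟩ := exists_map_add Q
  refine ⟨A, sub_eq_zero.1 (map_coord_eq_zero (B := -(cubicPoly (ZMod 4) * B)) ?_)⟩
  rw [map_sub, map_neg, map_mul, map_mul, map_cubicPoly, hQ]
  ring

lemma adjoinJ_injective : Function.Injective adjoinJ := by
  rw [injective_iff_map_eq_zero]
  intro y hy
  obtain ⟨P, rfl⟩ := Ideal.Quotient.mk_surjective y
  rw [Ideal.Quotient.eq_zero_iff_mem, Ideal.mem_span_singleton]
  refine cubicPoly_dvd_of_map ?_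
  rw [← Ideal.mem_span_singleton, ← Ideal.Quotient.eq_zero_iff_mem]
  exact hy

/-- A polynomial over `ℤ` whose class in `(ℤ/4)[u, v] / (u ^ 3 + u v + v ^ 3 + 1)` vanishes. -/
lemma exists_eq_cubicPoly_mul_add {P : PolyUV ℤ}
    (h : cubicPoly (ZMod 4) ∣ MvPolynomial.map (algebraMap ℤ (ZMod 4)) P) :
    ∃ A B : PolyUV ℤ, P = A * cubicPoly ℤ + 4 * B := by
  obtain ⟨Q, hQ⟩ := h
  obtain ⟨A, rfl⟩ := MvPolynomial.map_surjective (algebraMap ℤ (ZMod 4)) (ZMod.ringHom_surjective _) Q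
  have h0 : MvPolynomial.map (Int.castRingHom (ZMod 4)) (P - A * cubicPoly ℤ) = 0 := by
    rw [map_sub, map_mul, map_cubicPoly, sub_eq_zero, mul_comm]
    exact hQ
  obtain ⟨B, hB⟩ := (MvPolynomial.C_dvd_iff_zmod 4 _).2 h0
  refine ⟨A, B, ?_⟩
  have : (C ((4 : ℕ) : ℤ) : PolyUV ℤ) = 4 := by simp
  rw [this] at hB
  linear_combination hB

/-! ### Functoriality of Markov traces -/

namespace IsMarkovTrace

section

variable {S H : Type} [CommRing S] [Ring H] [Algebra S H] {M M' : Type*}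
  [AddCommGroup M] [Module S M] [Module (PolyUV S) M] [IsScalarTower S (PolyUV S) M]
  [AddCommGroup M'] [Module S M'] [Module (PolyUV S) M'] [IsScalarTower S (PolyUV S) M']
  {ρ : GammaInf →* H} {t : H →ₗ[S] M}

lemma map (ht : IsMarkovTrace ρ t) (f : M →ₗ[PolyUV S] M') :
    IsMarkovTrace ρ (f.restrictScalars S ∘ₗ t) where
  trace_mul_comm x y := congrArg f (ht.trace_mul_comm x y)
  trace_mul_gen n x hx := (congrArg f (ht.trace_mul_gen n x hx)).trans (map_smul f _ _)
  trace_mul_gen_inv n x hx := (congrArg f (ht.trace_mul_gen_inv n x hx)).trans (map_smul f _ _)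

end

variable {H : Type} [Ring H] [Algebra R4 H] {M : Type*}
  [AddCommGroup M] [Module R4 M] [Module (PolyUV R4) M] [IsScalarTower R4 (PolyUV R4) M]
  [Module (PolyUV ℤ) M] [IsScalarTower (PolyUV ℤ) (PolyUV R4) M]
  {ρ : GammaInf →* H} {t : H →ₗ[R4] M}

lemma comp_ringHom (ht : IsMarkovTrace ρ t) (φ : KInf →+* H)
    (hφ : ∀ g, φ (toQuot idealK g) = ρ g) :
    IsMarkovTrace (toQuot idealK) (t.toAddMonoidHom.comp φ.toAddMonoidHom).toIntLinearMap := by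
  have hX : ∀ i (m : M), (X i : PolyUV ℤ) • m = (X i : PolyUV R4) • m := fun i m => by
    rw [← algebraMap_smul (PolyUV R4) (X i : PolyUV ℤ) m, MvPolynomial.algebraMap_def, map_X]
  refine isMarkovTrace_of_generators (fun x y => ?_) (fun n g hg => ?_) (fun n g hg => ?_)
  · change t (φ (x * y)) = t (φ (y * x))
    rw [map_mul φ, map_mul φ, ht.trace_mul_comm]
  · change t (φ (_ * _)) = _ • t (φ _)
    rw [map_mul φ, hφ, hφ, hX]
    exact ht.trace_mul_gen n _ (Submodule.subset_span ⟨g, hg, rfl⟩)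
  · change t (φ (_ * _)) = _ • t (φ _)
    rw [map_mul φ, hφ, hφ, hX]
    exact ht.trace_mul_gen_inv n _ (Submodule.subset_span ⟨g, hg, rfl⟩)

/-- Pulling a trace back to `K_∞` makes the certificates apply to it. One `P` thus describes the
values in all algebras under `K_∞` at once. -/
lemma apply_eq_of_markovPoly (ht : IsMarkovTrace ρ t) (φ : KInf →+* H)
    (hφ : ∀ g, φ (toQuot idealK g) = ρ g) {x : KInf} {P : PolyUV ℤ} (h : MarkovPoly x P) :
    t (φ x) = MvPolynomial.map (algebraMap ℤ R4) P • t 1 := by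
  have := h.apply_eq (ht.comp_ringHom φ hφ)
  change t (φ x) = P • t (φ 1) at this
  rw [this, map_one, ← algebraMap_smul (PolyUV R4) P (t 1), MvPolynomial.algebraMap_def]

end IsMarkovTrace

end

/-! ### The Markov traces on the ternary Hecke algebra and on `K_∞` -/

lemma projHecke_toQuot (k : Fin 3) (g : GammaInf) :
    projHecke k (toQuot idealTernary g) = toQuot (idealHγ k) g := rfl

lemma quot_smul_one {S : Type} [CommRing S] (I : Ideal (PolyUV S)) (P : PolyUV S) :
    P • (1 : PolyUV S ⧸ I) = Ideal.Quotient.mk I P :=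
  congrArg (Ideal.Quotient.mk I) (mul_one P)

lemma C_smul_quot {S : Type} [CommRing S] (I : Ideal (PolyUV S)) (c : S) (y : PolyUV S ⧸ I) :
    (C c : PolyUV S) • y = c • y :=
  algebraMap_smul (PolyUV S) c y

/-- Specialization of the universal value ring at an element killed by the cubic polynomial. -/
lemma exists_specialization {N : Type*} [AddCommGroup N] [Module (PolyUV ℤ) N] {m : N}
    (hm : cubicPoly ℤ • m = 0) :
    ∃ f : CubicRing R4 →ₗ[PolyUV R4] PolyUV R4 ⊗[PolyUV ℤ] N,
      ∀ P, f (Ideal.Quotient.mk _ P) = P ⊗ₜ m := by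
  have hfe : cubicPoly R4 • ((1 : PolyUV R4) ⊗ₜ[PolyUV ℤ] m) = 0 := by
    rw [TensorProduct.smul_tmul', smul_eq_mul, mul_one]
    have h1 : cubicPoly R4 = cubicPoly ℤ • 1 := by
      rw [Algebra.smul_def, mul_one]
      exact (map_cubicPoly (algebraMap ℤ R4)).symm
    rw [h1, TensorProduct.smul_tmul, hm, TensorProduct.tmul_zero]
  refine ⟨Submodule.liftQ _ (LinearMap.toSpanSingleton (PolyUV R4) _ (1 ⊗ₜ m))
      (Submodule.span_le.2 (Set.singleton_subset_iff.2 hfe)), fun P => ?_⟩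
  change P • ((1 : PolyUV R4) ⊗ₜ[PolyUV ℤ] m) = _
  rw [TensorProduct.smul_tmul', smul_eq_mul, mul_one]

lemma redLin_smul (k : Fin 3) (P : PolyUV R4) (y : CubicRing R4) :
    redLin k (P • y) = P • redLin k y := by
  obtain ⟨Q, rfl⟩ := Ideal.Quotient.mk_surjective y
  rfl

lemma adjoinJ_smul (P : PolyUV ℤ) (y : CubicRing (ZMod 4)) :
    adjoinJ (P • y) = MvPolynomial.map (algebraMap ℤ R4) P • adjoinJ y := by
  obtain ⟨Q, rfl⟩ := Ideal.Quotient.mk_surjective y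
  have h : MvPolynomial.map (algebraMap ℤ R4) P =
      mapR4 (MvPolynomial.map (algebraMap ℤ (ZMod 4)) P) := by
    rw [mapR4, MvPolynomial.map_map, ← IsScalarTower.algebraMap_eq]
  have hs : P • Ideal.Quotient.mk (Ideal.span {cubicPoly (ZMod 4)}) Q =
      Ideal.Quotient.mk _ (MvPolynomial.map (algebraMap ℤ (ZMod 4)) P * Q) := by
    rw [← algebraMap_smul (PolyUV (ZMod 4)) P, MvPolynomial.algebraMap_def]
    rfl
  rw [hs, h]
  exact congrArg (Ideal.Quotient.mk _) (map_mul mapR4 _ _)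

set_option maxHeartbeats 1000000 in
/-- The trace on the ternary Hecke algebra, from compatible traces on the Hecke algebras. -/
theorem exists_ternaryTrace (tr : ∀ k : Fin 3, HeckeInf k →ₗ[R4] LinRing k)
    (htr : ∀ k, IsMarkovTrace (toQuot (idealHγ k)) (tr k)) (h1 : ∀ k, tr k 1 = 1) :
    ∃ tbar : TernaryInf →ₗ[R4] CubicRing R4,
      IsMarkovTrace (toQuot idealTernary) tbar ∧ tbar 1 = 1 ∧
        ∀ h y, tbar h = y ↔ ∀ k, redLin k y = tr k (projHecke k h) := by
  have hex : ∀ h : TernaryInf, ∃ y, ∀ k, redLin k y = tr k (projHecke k h) := by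
    intro h
    induction h using toQuot_induction with
    | of g =>
      -- Group elements come from `K_∞`, so a single integral `P` reduces to the three trace values.
      -- Linearity over `R4` covers the rest.
      obtain ⟨P, hP⟩ := exists_markovPoly (toQuot idealK g)
      refine ⟨Ideal.Quotient.mk _ (MvPolynomial.map (algebraMap ℤ R4) P), fun k => ?_⟩
      have := (htr k).apply_eq_of_markovPoly
        ((projHecke k : TernaryInf →+* HeckeInf k).comp piMap) (fun g => by
          rw [RingHom.comp_apply, piMap_toQuot]; exact projHecke_toQuot k g) hP
      rw [RingHom.comp_apply, piMap_toQuot, h1] at this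
      refine Eq.trans ?_ this.symm
      exact (quot_smul_one _ _).symm
    | add x z hx hz =>
      obtain ⟨a, ha⟩ := hx
      obtain ⟨b, hb⟩ := hz
      exact ⟨a + b, fun k => by rw [map_add, map_add, map_add, ha, hb]⟩
    | smul c x hx =>
      obtain ⟨a, ha⟩ := hx
      refine ⟨(C c : PolyUV R4) • a, fun k => ?_⟩
      rw [redLin_smul, ha, map_smul, map_smul, C_smul_quot]
  choose F hF using hex
  have huniq : ∀ h y, (∀ k, redLin k y = tr k (projHecke k h)) → F h = y := fun h y hy =>
    redLin_injective fun k => (hF h k).trans (hy k).symm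
  let tbar : TernaryInf →ₗ[R4] CubicRing R4 :=
    { toFun := F
      map_add' := fun x y => huniq _ _ fun k => by
        rw [map_add, map_add, map_add, hF, hF]
      map_smul' := fun c x => (huniq _ ((C c : PolyUV R4) • F x) fun k => by
        rw [redLin_smul, hF, map_smul (projHecke k), map_smul (tr k)]
        exact C_smul_quot _ c _).trans (C_smul_quot _ c (F x)) }
  refine ⟨tbar, isMarkovTrace_of_generators (fun x y => huniq _ _ fun k => ?_)
    (fun n g hg => huniq _ _ fun k => ?_) (fun n g hg => huniq _ _ fun k => ?_),
    huniq _ _ fun k => ?_, fun h y => ⟨?_, huniq h y⟩⟩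
  · change redLin k (F _) = _
    rw [hF, map_mul (projHecke k), map_mul (projHecke k), (htr k).trace_mul_comm]
  · change redLin k (_ • F _) = _
    rw [redLin_smul, hF, map_mul (projHecke k)]
    exact ((htr k).trace_mul_gen n _ (Submodule.subset_span ⟨g, hg, rfl⟩)).symm
  · change redLin k (_ • F _) = _
    rw [redLin_smul, hF, map_mul (projHecke k)]
    exact ((htr k).trace_mul_gen_inv n _ (Submodule.subset_span ⟨g, hg, rfl⟩)).symm
  · rw [map_one, map_one, h1]
  · rintro rfl
    exact hF h

/-- The trace on `K_∞`, by descent. -/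
theorem exists_traceK (tbar : TernaryInf →ₗ[R4] CubicRing R4)
    (ht : IsMarkovTrace (toQuot idealTernary) tbar) (h1 : tbar 1 = 1) :
    ∃ tbar₀ : KInf →ₗ[ℤ] CubicRing (ZMod 4), IsMarkovTrace (toQuot idealK) tbar₀ ∧ tbar₀ 1 = 1 ∧
      ∀ x, tbar (piMap x) = adjoinJ (tbar₀ x) := by
  have hex : ∀ x : KInf, ∃ y, adjoinJ y = tbar (piMap x) := by
    intro x
    obtain ⟨P, hP⟩ := exists_markovPoly x
    -- On the image of `K_∞` the values are classes of integral polynomials, hence lie in the image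
    -- of `adjoinJ`.
    refine ⟨P • 1, ?_⟩
    rw [ht.apply_eq_of_markovPoly piMap piMap_toQuot hP, adjoinJ_smul, map_one, h1]
  choose F hF using hex
  have huniq : ∀ x y, adjoinJ y = tbar (piMap x) → F x = y := fun x y hy =>
    adjoinJ_injective ((hF x).trans hy.symm)
  have hX : ∀ i, MvPolynomial.map (algebraMap ℤ R4) (X i : PolyUV ℤ) = X i := fun i => map_X _ i
  let tbar₀ : KInf →ₗ[ℤ] CubicRing (ZMod 4) := AddMonoidHom.toIntLinearMap
    { toFun := F
      map_zero' := huniq _ _ (by rw [map_zero, map_zero, map_zero])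
      map_add' := fun x y => huniq _ _ (by rw [map_add, map_add, map_add, hF, hF]) }
  refine ⟨tbar₀, isMarkovTrace_of_generators (fun x y => huniq _ _ ?_)
    (fun n g hg => huniq _ _ ?_) (fun n g hg => huniq _ _ ?_), huniq _ _ ?_, fun x => (hF x).symm⟩
  · change adjoinJ (F _) = _
    rw [hF, map_mul piMap, map_mul piMap, ht.trace_mul_comm]
  · change adjoinJ (_ • F _) = _
    rw [adjoinJ_smul, hF, map_mul piMap, piMap_toQuot, piMap_toQuot, hX]
    exact (ht.trace_mul_gen n _ (Submodule.subset_span ⟨g, hg, rfl⟩)).symm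
  · change adjoinJ (_ • F _) = _
    rw [adjoinJ_smul, hF, map_mul piMap, piMap_toQuot, piMap_toQuot, hX]
    exact (ht.trace_mul_gen_inv n _ (Submodule.subset_span ⟨g, hg, rfl⟩)).symm
  · rw [map_one, map_one, h1]

/-! ### Universality among the traces with `4 t(1) = 0` -/

section Universal

variable {M : Type*} [AddCommGroup M] [Module (PolyUV ℤ) M] {t : KInf →ₗ[ℤ] M}

namespace IsMarkovTrace

lemma mem_span (hM : IsMarkovTrace (toQuot idealK) t) (x : KInf) :
    t x ∈ Submodule.span (PolyUV ℤ) {t 1} := by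
  obtain ⟨P, hP⟩ := exists_markovPoly x
  rw [hP.apply_eq hM]
  exact Submodule.smul_mem _ _ (Submodule.mem_span_singleton_self _)

/-- If `t x = P • t 1`, then `P` vanishes in the universal value ring by injectivity of `adjoinJ`.
It is therefore a combination of the cubic and 4, both of which kill `t 1`. -/
lemma eq_zero_of_piMap_eq_zero (hM : IsMarkovTrace (toQuot idealK) t) (h4 : (4 : ℤ) • t 1 = 0)
    {tbar : TernaryInf →ₗ[R4] CubicRing R4} {tbar₀ : KInf →ₗ[ℤ] CubicRing (ZMod 4)}
    (ht₀ : IsMarkovTrace (toQuot idealK) tbar₀) (ht₀1 : tbar₀ 1 = 1)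
    (hadj : ∀ x, tbar (piMap x) = adjoinJ (tbar₀ x)) {x : KInf} (hx : piMap x = 0) : t x = 0 := by
  have hf := hM.cubicPoly_smul h4
  have h4' : (4 : PolyUV ℤ) • t 1 = 0 := by
    rw [← h4, ← Int.cast_smul_eq_zsmul (PolyUV ℤ)]
    norm_num
  obtain ⟨P, hP⟩ := exists_markovPoly x
  have h := hadj x
  rw [hx, map_zero, eq_comm, map_eq_zero_iff _ adjoinJ_injective, hP.apply_eq ht₀, ht₀1,
    ← algebraMap_smul (PolyUV (ZMod 4)) P, quot_smul_one] at h
  have hdvd : cubicPoly (ZMod 4) ∣ MvPolynomial.map (algebraMap ℤ (ZMod 4)) P :=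
    Ideal.mem_span_singleton.1 (Ideal.Quotient.eq_zero_iff_mem.1 h)
  obtain ⟨A, B, rfl⟩ := exists_eq_cubicPoly_mul_add hdvd
  rw [hP.apply_eq hM, add_smul, mul_smul, hf, smul_zero, mul_comm, mul_smul, h4', smul_zero,
    add_zero]

lemma _root_.exists_factor_piMap {M : Type*} [AddCommGroup M] {t : KInf →ₗ[ℤ] M}
    (hker : ∀ x, piMap x = 0 → t x = 0) :
    ∃ τ : piMap.range →+ M, ∀ x, τ (piMap.rangeRestrict x) = t x := by
  have hsurj := piMap.rangeRestrict_surjective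
  refine ⟨AddMonoidHom.liftOfSurjective piMap.rangeRestrict.toAddMonoidHom hsurj
    ⟨t.toAddMonoidHom, fun x hx => hker x ?_⟩, fun x => ?_⟩
  · exact congrArg Subtype.val hx
  · exact AddMonoidHom.liftOfRightInverse_comp_apply _ _ _ _ x

/-- `t'` is `tbar` followed by the linear map sending the class of `P` to `P ⊗ t(1)`, which is well
defined because the cubic kills `t 1`. -/
lemma exists_extension (hM : IsMarkovTrace (toQuot idealK) t) (h4 : (4 : ℤ) • t 1 = 0)
    {tbar : TernaryInf →ₗ[R4] CubicRing R4} (ht : IsMarkovTrace (toQuot idealTernary) tbar)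
    (ht1 : tbar 1 = 1) :
    ∃ t₀ : KInf →ₗ[ℤ] Submodule.span (PolyUV ℤ) {t 1}, (∀ x, (t₀ x : M) = t x) ∧
      ∃ t' : TernaryInf →ₗ[R4] PolyUV R4 ⊗[PolyUV ℤ] Submodule.span (PolyUV ℤ) {t 1},
        IsMarkovTrace (toQuot idealTernary) t' ∧
        (∀ x, t' (piMap x) = 1 ⊗ₜ[PolyUV ℤ] t₀ x) ∧
        ∀ h (P : PolyUV R4), tbar h = Ideal.Quotient.mk _ P → t' h = P ⊗ₜ[PolyUV ℤ] t₀ 1 := by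
  let t₀ : KInf →ₗ[ℤ] Submodule.span (PolyUV ℤ) {t 1} := AddMonoidHom.toIntLinearMap
    { toFun := fun x => ⟨t x, hM.mem_span x⟩
      map_zero' := Subtype.ext (map_zero t)
      map_add' := fun x y => Subtype.ext (map_add t x y) }
  have ht₀P : ∀ {x P}, MarkovPoly x P → t₀ x = P • t₀ 1 := fun h => Subtype.ext (h.apply_eq hM)
  obtain ⟨Λ, hΛ⟩ := exists_specialization (m := t₀ 1) (Subtype.ext (hM.cubicPoly_smul h4))
  refine ⟨t₀, fun _ => rfl, Λ.restrictScalars R4 ∘ₗ tbar, ht.map Λ, fun x => ?_, fun h P hP => ?_⟩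
  · obtain ⟨P, hP⟩ := exists_markovPoly x
    have h : tbar (piMap x) = Ideal.Quotient.mk _ (MvPolynomial.map (algebraMap ℤ R4) P) := by
      rw [ht.apply_eq_of_markovPoly piMap piMap_toQuot hP, ht1, quot_smul_one]
    have h1 : MvPolynomial.map (algebraMap ℤ R4) P = P • 1 := by
      rw [Algebra.smul_def, mul_one]
      rfl
    change Λ (tbar (piMap x)) = _
    rw [h, hΛ, ht₀P hP, h1, TensorProduct.smul_tmul]
  · change Λ (tbar h) = _
    rw [hP, hΛ]

end IsMarkovTrace

end Universal

theorem proposition7p7 :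
    ∃ (π : KInf →+* TernaryInf)
      (tr : ∀ k : Fin 3, HeckeInf k →ₗ[R4] LinRing k)
      (tbar : TernaryInf →ₗ[R4] CubicRing R4)
      (tbar₀ : KInf →ₗ[ℤ] CubicRing (ZMod 4)),
      -- the natural map from `K_∞` to the ternary Hecke algebra
      (∀ g : GammaInf, π (toQuot idealK g) = toQuot idealTernary g) ∧
      -- the Markov traces of the three Hecke algebras
      (∀ k, IsMarkovTrace (toQuot (idealHγ k)) (tr k) ∧ tr k 1 = 1) ∧
      -- the Markov trace on the ternary Hecke algebra, induced by these three
      (IsMarkovTrace (toQuot idealTernary) tbar ∧ tbar 1 = 1 ∧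
        ∀ h y, tbar h = y ↔ ∀ k, redLin k y = tr k (projHecke k h)) ∧
      -- its form over `ℤ/4`
      (IsMarkovTrace (toQuot idealK) tbar₀ ∧ tbar₀ 1 = 1 ∧
        ∀ x, tbar (π x) = adjoinJ (tbar₀ x)) ∧
      -- every Markov trace on `K_∞` with `4 t(1) = 0`
      (∀ (M : Type*) [AddCommGroup M] [Module (PolyUV ℤ) M] (t : KInf →ₗ[ℤ] M),
        IsMarkovTrace (toQuot idealK) t → (4 : ℤ) • t 1 = 0 →
        -- factors through the image of `K_∞` in the ternary Hecke algebra
        (∃ τ : π.range →+ M, ∀ x, τ (π.rangeRestrict x) = t x) ∧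
        -- and, after extension of scalars, is the restriction of a Markov trace `t'` on the
        -- whole ternary Hecke algebra, obtained from `tbar` by specialization
        ∃ t₀ : KInf →ₗ[ℤ] Submodule.span (PolyUV ℤ) {t 1},
          (∀ x, (t₀ x : M) = t x) ∧
          ∃ t' : TernaryInf →ₗ[R4] PolyUV R4 ⊗[PolyUV ℤ] Submodule.span (PolyUV ℤ) {t 1},
            IsMarkovTrace (toQuot idealTernary) t' ∧
            (∀ x, t' (π x) = 1 ⊗ₜ[PolyUV ℤ] t₀ x) ∧
            ∀ h (P : PolyUV R4), tbar h = Ideal.Quotient.mk _ P → t' h = P ⊗ₜ[PolyUV ℤ] t₀ 1) := by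
  choose tr htr htr1 using exists_heckeTrace
  obtain ⟨tbar, ht, ht1, hchar⟩ := exists_ternaryTrace tr htr htr1
  obtain ⟨tbar₀, ht₀, ht₀1, hadj⟩ := exists_traceK tbar ht ht1
  refine ⟨piMap, tr, tbar, tbar₀, piMap_toQuot, fun k => ⟨htr k, htr1 k⟩, ⟨ht, ht1, hchar⟩,
    ⟨ht₀, ht₀1, hadj⟩, ?_⟩
  intro M _ _ t hM h4
  exact ⟨exists_factor_piMap fun _ => hM.eq_zero_of_piMap_eq_zero h4 ht₀ ht₀1 hadj,
    hM.exists_extension h4 ht ht1⟩
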